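/- A finite simplicial complex $K$ of $\mathbb{R}^n$ is a finite family of (closed) simplices of $\mathbb{R}^n$ that contains all faces of its members and in which any two members are disjoint or meet in a common face; $|K|\subset\mathbb{R}^n$ is the union of its simplices. A map $h\colon|K|\to|L|$ is simplicial if on each simplex of $K$ it is the restriction of an affine map, and it maps the vertices of each simplex of $K$ onto the vertices of a simplex of $L$. For a bounded map $f\colon X\to\mathbb{R}^m$ put $\|f\|:=\sup_{x\in X}|f(x)|$, with $|\cdot|$ the Euclidean norm (and $\|f\|:=0$ if $X=\varnothing$). Let $\tau\subset\mathbb{R}^m$ be a simplex of dimension $\ge 1$ with boundary $\partial\tau$ (the union of its proper faces), relative interior $\mathring\tau=\tau\setminus\partial\tau$, affine hull $H_\tau$ and barycentre $b_\tau$, and let $\delta_\tau:=\operatorname{dist}(b_\tau,\partial\tau)>0$. For $0<\varepsilon<\delta_\tau$ let $\theta_{\tau,\varepsilon}(x):=b_\tau+\frac{\varepsilon}{\delta_\tau}(x-b_\tau)$ on $H_\tau$, let $\rho_{\tau}\colon H_\tau\setminus\{b_\tau\}\to\partial\tau$ send $x$ to the unique point of $\partial\tau$ on the ray $\{b_\tau+t(x-b_\tau):t\ge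 0\}$, and define $\pi_{\tau,\varepsilon}\colon\tau\to\tau$ by $\pi_{\tau,\varepsilon}(x):=\theta_{\tau,\varepsilon}^{-1}(x)$ if $x\in\theta_{\tau,\varepsilon}(\tau)$, and $\pi_{\tau,\varepsilon}(x):=\rho_{\tau}(x)$ if $x\in\tau\setminus\theta_{\tau,\varepsilon}(\mathring\tau)$. For a finite simplicial complex $L$ of $\mathbb{R}^m$, let $\tau_1,\dots,\tau_s$ be its maximal simplices of dimension $\ge 1$. For $\varepsilon>0$ with $\varepsilon<\delta_{\tau_i}$ for all $i$, let $\widehat\pi_{\tau_i,\varepsilon}\colon|L|\to|L|$ be the extension of $\pi_{\tau_i,\varepsilon}$ by the identity on $|L|\setminus\mathring\tau_i$. The $\varepsilon$-squeezing map of $L$ is $$\pi_\varepsilon:=\widehat\pi_{\tau_s,\varepsilon}\circ\cdots\circ\widehat\pi_{\tau_1,\varepsilon}\colon|L|\to|L|$$ (it does not depend on the order of the $\tau_i$, and it is the identity if $s=0$). **Proposition.** Let $K$ be a finite simplicial complex of $\mathbb{R}^n$, $L$ a finite simplicial complex of $\mathbb{R}^m$ and $h\colon|K|\to|L|$ a surjective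 simplicial map. Then there exists $\varepsilon>0$, smaller than $\delta_\tau$ for every maximal simplex $\tau$ of $L$ of dimension $\ge1$, such that for every continuous map $g\colon|K|\to|L|$ with $\|h-g\|<\varepsilon$: * $\pi_\varepsilon\circ g\colon|K|\to|L|$ is surjective; * if $L$ has a simplex of dimension $\ge 1$, then $\|h-\pi_\varepsilon\circ g\|<2\max_{\tau\in L}\operatorname{diam}(\tau)$. -/

import Mathlib

noncomputable section

namespace Squeezing

open Geometry Set

section Simplex

variable {E : Type*} [NormedAddCommGroup E] [NormedSpace ℝ E]

/-- The simplex with vertex set `s` (for `s` affinely independent). -/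
def simplex (s : Finset E) : Set E := convexHull ℝ (s : Set E)

/-- The (relative) boundary of the simplex with vertex set `s`: the union of its proper faces. -/
def simplexBoundary (s : Finset E) : Set E := ⋃ t ∈ {t : Finset E | t ⊂ s}, simplex t

/-- The barycentre of the simplex with vertex set `s`. -/
def barycentre (s : Finset E) : E := (s.card : ℝ)⁻¹ • ∑ v ∈ s, v

/-- The distance of the barycentre from the boundary. -/
def inradius (s : Finset E) : ℝ := Metric.infDist (barycentre s) (simplexBoundary s)

/-- The ray that starts at `z` and passes through `x`. -/
def rayThrough (z x : E) : Set E := {y | ∃ t : ℝ, 0 ≤ t ∧ y = z + t • (x - z)}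

open Classical in
/-- The radial retraction from the barycentre onto the boundary: `x` is sent to the point in which
the ray from the barycentre through `x` meets the boundary. For `x` in the affine span of the simplex
and different from the barycentre there is exactly one such point, see
`rayThrough_inter_simplexBoundary`; other points `x` do not matter. -/
def radialRetraction (s : Finset E) (x : E) : E :=
  if hx : (rayThrough (barycentre s) x ∩ simplexBoundary s).Nonempty then hx.some else x

/-- The homothety with centre the barycentre of `s` and ratio `ε / inradius s`. -/
def shrink (s : Finset E) (ε : ℝ) : E →ᵃ[ℝ] E :=
  AffineMap.homothety (barycentre s) (ε / inradius s)

/-- The inverse homothety of `shrink s ε` (for `ε` and `inradius s` positive). -/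
def expand (s : Finset E) (ε : ℝ) : E →ᵃ[ℝ] E :=
  AffineMap.homothety (barycentre s) (inradius s / ε)

open Classical in
/-- The squeezing map of a single simplex: it expands the shrunken copy of the simplex onto the
simplex, and pushes the rest of the simplex radially onto the boundary. It is extended by the
identity outside the simplex. -/
def squeezeSimplex (s : Finset E) (ε : ℝ) (x : E) : E :=
  if x ∈ simplex s then
    if x ∈ shrink s ε '' simplex s then expand s ε x else radialRetraction s x
  else x

theorem expand_shrink {s : Finset E} {ε : ℝ} (hε : 0 < ε) (hs : 0 < inradius s) (x : E) :
    expand s ε (shrink s ε x) = x := by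
  simp only [expand, shrink, AffineMap.homothety_apply, vsub_eq_sub, vadd_eq_add,
    add_sub_cancel_right, smul_smul]
  rw [show inradius s / ε * (ε / inradius s) = 1 by field_simp]
  simp

/-- A point with barycentric coordinates `u` is in the boundary exactly if these are nonnegative
and one of them vanishes. -/
theorem sum_mem_simplexBoundary_iff {s : Finset E}
    (hs : AffineIndependent ℝ ((↑) : s → E)) {u : E → ℝ} (hu : ∑ v ∈ s, u v = 1) :
    ∑ v ∈ s, u v • v ∈ simplexBoundary s ↔ (∀ v ∈ s, 0 ≤ u v) ∧ ∃ v ∈ s, u v = 0 := by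
  classical
  constructor
  · intro h
    simp only [simplexBoundary, simplex, mem_iUnion, mem_ofPred_eq, Finset.mem_convexHull'] at h
    obtain ⟨t, ht, c, hc0, hc1, hc⟩ := h
    have key : ∀ v ∈ s, u v = if v ∈ t then c v else 0 := by
      have h1 : ∑ v ∈ s, (u v - if v ∈ t then c v else 0) = 0 := by
        rw [Finset.sum_sub_distrib, hu, ← Finset.sum_filter,
          Finset.filter_mem_eq_inter, Finset.inter_eq_right.2 ht.1, hc1, sub_self]
      have h2 : ∑ v ∈ s, (u v - if v ∈ t then c v else 0) • v = 0 := by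
        simp only [sub_smul, Finset.sum_sub_distrib, ite_smul, zero_smul]
        rw [← Finset.sum_filter, Finset.filter_mem_eq_inter, Finset.inter_eq_right.2 ht.1, hc,
          sub_self]
      have h3 := affineIndependent_iff.1 hs Finset.univ
        (fun v => u v - if (v : E) ∈ t then c v else 0)
        ((Finset.sum_coe_sort s (fun v => u v - if v ∈ t then c v else 0)).trans h1)
        ((Finset.sum_coe_sort s (fun v => (u v - if v ∈ t then c v else 0) • v)).trans h2)
      intro v hv
      have := h3 ⟨v, hv⟩ (Finset.mem_univ _)
      exact sub_eq_zero.1 this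
    refine ⟨fun v hv => ?_, ?_⟩
    · rw [key v hv]
      split_ifs with h
      · exact hc0 v h
      · exact le_rfl
    · obtain ⟨v, hv, hvt⟩ := Finset.exists_of_ssubset ht
      exact ⟨v, hv, by rw [key v hv, if_neg hvt]⟩
  · rintro ⟨h0, v, hv, hv0⟩
    simp only [simplexBoundary, simplex, mem_iUnion, mem_ofPred_eq, Finset.mem_convexHull']
    refine ⟨s.erase v, Finset.erase_ssubset hv, u, fun w hw => h0 w (Finset.mem_of_mem_erase hw),
      ?_, ?_⟩
    · rw [← hu, Finset.sum_erase _ hv0]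
    · rw [Finset.sum_erase _ (by rw [hv0, zero_smul])]

/-- The ray from the barycentre through any other point of the affine span of the simplex meets the
boundary exactly in the value of `radialRetraction`. -/
theorem rayThrough_inter_simplexBoundary {s : Finset E}
    (hs : AffineIndependent ℝ ((↑) : s → E)) {x : E} (hx : x ∈ affineSpan ℝ (s : Set E))
    (hxb : x ≠ barycentre s) :
    rayThrough (barycentre s) x ∩ simplexBoundary s = {radialRetraction s x} := by
  classical
  obtain ⟨w, hw1, hwx⟩ : ∃ w : E → ℝ, ∑ v ∈ s, w v = 1 ∧ ∑ v ∈ s, w v • v = x := by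
    have hx' : x ∈ affineSpan ℝ (Set.range ((↑) : s → E)) := by
      simpa using hx
    obtain ⟨w, hw, rfl⟩ := eq_affineCombination_of_mem_affineSpan_of_fintype hx'
    refine ⟨fun v => if h : v ∈ s then w ⟨v, h⟩ else 0, ?_, ?_⟩
    · rw [← Finset.sum_coe_sort s, ← hw]
      exact Finset.sum_congr rfl fun v _ => by simp
    · rw [Finset.affineCombination_eq_linear_combination _ _ _ hw, ← Finset.sum_coe_sort s]
      exact Finset.sum_congr rfl fun v _ => by simp
  have hne : s.Nonempty := by
    rw [Finset.nonempty_iff_ne_empty]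
    rintro rfl
    simp at hw1
  have hk : (0 : ℝ) < s.card := by exact_mod_cast hne.card_pos
  set k : ℝ := (s.card : ℝ) with hkdef
  have hbsum : barycentre s = ∑ v ∈ s, k⁻¹ • v := by
    rw [barycentre, Finset.smul_sum]
  have hpt : ∀ t : ℝ, barycentre s + t • (x - barycentre s)
      = ∑ v ∈ s, (k⁻¹ + t * (w v - k⁻¹)) • v := by
    intro t
    rw [hbsum, ← hwx, ← Finset.sum_sub_distrib, Finset.smul_sum, ← Finset.sum_add_distrib]
    refine Finset.sum_congr rfl fun v _ => ?_
    module
  have hk1 : ∑ _v ∈ s, k⁻¹ = 1 := by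
    rw [Finset.sum_const, nsmul_eq_mul, ← hkdef]
    field_simp
  have hsum0 : ∑ v ∈ s, (w v - k⁻¹) = 0 := by
    rw [Finset.sum_sub_distrib, hw1, hk1, sub_self]
  have hsum1 : ∀ t : ℝ, ∑ v ∈ s, (k⁻¹ + t * (w v - k⁻¹)) = 1 := by
    intro t
    rw [Finset.sum_add_distrib, ← Finset.mul_sum, hsum0, hk1, mul_zero, add_zero]
  have hmem : ∀ t : ℝ, barycentre s + t • (x - barycentre s) ∈ simplexBoundary s ↔
      (∀ v ∈ s, 0 ≤ k⁻¹ + t * (w v - k⁻¹)) ∧ ∃ v ∈ s, k⁻¹ + t * (w v - k⁻¹) = 0 := by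
    intro t
    rw [hpt, sum_mem_simplexBoundary_iff hs (hsum1 t)]
  have hki : 0 < k⁻¹ := inv_pos.2 hk
  -- at most one point
  have huniq : ∀ t t' : ℝ, 0 ≤ t → t < t' →
      barycentre s + t • (x - barycentre s) ∈ simplexBoundary s →
      barycentre s + t' • (x - barycentre s) ∈ simplexBoundary s → False := by
    intro t t' ht htt h h'
    obtain ⟨-, v, hv, hv0⟩ := (hmem t).1 h
    have h1 := ((hmem t').1 h').1 v hv
    have ha : w v - k⁻¹ < 0 := by
      by_contra hcon
      push Not at hcon
      nlinarith [mul_nonneg ht hcon]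
    nlinarith [mul_pos_of_neg_of_neg (sub_neg.2 htt) ha]
  -- at least one point
  have hex : (rayThrough (barycentre s) x ∩ simplexBoundary s).Nonempty := by
    obtain ⟨v₀, hv₀, hmin⟩ := Finset.exists_min_image s (fun v => w v - k⁻¹) hne
    have hneg : w v₀ - k⁻¹ < 0 := by
      by_contra hcon
      push Not at hcon
      have h0 : ∀ v ∈ s, 0 ≤ w v - k⁻¹ := fun v hv => hcon.trans (hmin v hv)
      have h1 := (Finset.sum_eq_zero_iff_of_nonneg h0).1 hsum0
      apply hxb
      rw [hbsum, ← hwx]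
      exact Finset.sum_congr rfl fun v hv => by rw [sub_eq_zero.1 (h1 v hv)]
    have ht : 0 < k⁻¹ / -(w v₀ - k⁻¹) := div_pos hki (by linarith)
    refine ⟨_, ⟨k⁻¹ / -(w v₀ - k⁻¹), ht.le, rfl⟩, (hmem _).2 ⟨fun v hv => ?_, v₀, hv₀, ?_⟩⟩
    · have h1 := mul_le_mul_of_nonneg_left (hmin v hv) ht.le
      have h2 : k⁻¹ / -(w v₀ - k⁻¹) * (w v₀ - k⁻¹) = -k⁻¹ := by
        have := hneg.ne
        generalize w v₀ - k⁻¹ = a at *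
        field_simp
      linarith
    · have := hneg.ne
      generalize w v₀ - k⁻¹ = a at *
      field_simp
      ring
  have hsome : radialRetraction s x ∈ rayThrough (barycentre s) x ∩ simplexBoundary s := by
    rw [radialRetraction, dif_pos hex]
    exact hex.some_mem
  refine Subset.antisymm ?_ (by simpa using hsome)
  rintro y ⟨⟨t, ht, rfl⟩, hy⟩
  obtain ⟨⟨t', ht', e⟩, hy'⟩ := hsome
  rw [mem_singleton_iff, e]
  rw [e] at hy'
  rcases lt_trichotomy t t' with h | rfl | h
  · exact (huniq t t' ht h hy hy').elim
  · rfl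
  · exact (huniq t' t ht' h hy' hy).elim

end Simplex

section Complex

variable {E F : Type*} [NormedAddCommGroup E] [NormedSpace ℝ E]
  [NormedAddCommGroup F] [NormedSpace ℝ F]

/-- A map `h : |K| → |L|` is simplicial if it is affine on each simplex of `K` and sends the vertices
of each simplex of `K` onto the set of vertices of a simplex of `L`. -/
structure IsSimplicialMap (K : SimplicialComplex ℝ E) (L : SimplicialComplex ℝ F)
    (h : K.space → L.space) : Prop where
  affine_on_simplex : ∀ s ∈ K.faces, ∃ A : E →ᵃ[ℝ] F,
    ∀ x : K.space, (x : E) ∈ simplex s → (h x : F) = A x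
  map_vertices : ∀ s ∈ K.faces, ∃ t ∈ L.faces,
    (t : Set F) = {y | ∃ x : K.space, (x : E) ∈ s ∧ (h x : F) = y}

/-- The maximal simplices of dimension at least one, given by their vertex sets. -/
def maximalSimplices (L : SimplicialComplex ℝ F) : Set (Finset F) :=
  {s | s ∈ L.facets ∧ 2 ≤ s.card}

theorem finite_maximalSimplices {L : SimplicialComplex ℝ F} (hL : L.faces.Finite) :
    (maximalSimplices L).Finite :=
  hL.subset fun _ hs => SimplicialComplex.facets_subset hs.1

/-- The `ε`-squeezing map of a finite simplicial complex `L`: the composition, in some order, of the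
squeezing maps of the maximal simplices of dimension at least one. It is used as a map on `|L|`, for
positive `ε` smaller than the `inradius` of all these simplices; the order does not matter then. -/
def squeezingMap (L : SimplicialComplex ℝ F) (hL : L.faces.Finite) (ε : ℝ) : F → F :=
  ((finite_maximalSimplices hL).toFinset.toList.map fun s => squeezeSimplex s ε).foldr
    (fun p q => p ∘ q) id

/-- The uniform norm of a bounded map. -/
def uniformNorm {X : Type*} (f : X → F) : ℝ := ⨆ x, ‖f x‖

/-- The maximal diameter of the simplices of a (nonempty finite) complex. -/
def maxDiam (L : SimplicialComplex ℝ F) : ℝ :=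
  sSup ((fun s : Finset F => Metric.diam (simplex s)) '' L.faces)

end Complex

end Squeezing

end

/-! Over each maximal simplex `τ` of `L` the map `h` has an affine section `B`
(`exists_affine_section`): some simplex of `K` hits the barycentre of `τ`, its image is a simplex of
`L` through that barycentre, hence `τ` itself by maximality, and choosing a vertex over each vertex
of `τ` determines `B`. If `g` is `ε`-close to `h`, then `G = g ∘ B` is an `ε`-perturbation of the
identity of `τ`.

Such a perturbation may miss part of `τ`, but it covers the shrunken copy
(`exists_eq_shrink_of_close`). For `p` in that copy consider `y ↦ P (y - G y) + p`, with `P` the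
orthogonal projection onto the direction of the affine span of `τ`. It maps `τ` to itself, since
points of the span at distance at most `inradius τ - ε` from the copy lie in `τ`; Brouwer's theorem
gives a fixed point `y`. There `G y` is within `2 * ε` of `p`. For small `ε` nothing of `|L|` but
`τ` is that close to the copy, so `y - G y` is fixed by `P`, and `G y = p`. Squeezing then expands
the copy onto `τ`. Maximal simplices of dimension zero are isolated points of `|L|`, which `g` hits
directly.

For the estimate, squeezing preserves every maximal simplex, so it moves points by at most the
maximal diameter, and `ε` is smaller than an inradius, hence than that diameter.

Brouwer's theorem is derived from Scarf's combinatorial lemma, applied to lattice points of a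
dilated standard simplex; the lemma is a parity count of incidences between dominant sets of size
`|I| - 1` (doors) and `|I|` (rooms). -/

/-! ### Scarf's lemma -/

section Scarf

variable {T I : Type*}

/-- A finite set `σ` is dominant for a family of rankings if every point is, in one of the rankings,
at most as high as all points of `σ`. -/
def ScarfDominant (r : I → T → ℕ) (σ : Finset T) : Prop :=
  ∀ y, ∃ i, ∀ x ∈ σ, r i y ≤ r i x

/-- The points that exceed the minimum of `τ` in all rankings other than the `k`-th one. -/
def scarfUpper (r : I → T → ℕ) (τ : Finset T) (k : I) : Set T :=
  {y | ∀ l, l ≠ k → ∃ x ∈ τ, r l x < r l y}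

theorem ScarfDominant.mono {r : I → T → ℕ} {σ τ : Finset T} (h : ScarfDominant r σ) (hτ : τ ⊆ σ) :
    ScarfDominant r τ := fun y => (h y).imp fun _ hi x hx => hi x (hτ hx)

/-- The ranking in which `x` is dominated has `x` as its minimizer. -/
theorem ScarfDominant.exists_minimizer_eq {r : I → T → ℕ} (hr : ∀ i, Function.Injective (r i))
    {σ : Finset T} (h : ScarfDominant r σ) {m : I → T} (hm : ∀ i, m i ∈ σ)
    (hmin : ∀ i, ∀ x ∈ σ, r i (m i) ≤ r i x) : ∀ x ∈ σ, ∃ i, m i = x := by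
  intro x hx
  obtain ⟨i, hi⟩ := h x
  exact ⟨i, hr i (le_antisymm (hmin i x hx) (hi _ (hm i)))⟩

theorem exists_rank_minimizer (r : I → T → ℕ) {σ : Finset T} (hσ : σ.Nonempty) :
    ∃ m : I → T, (∀ i, m i ∈ σ) ∧ ∀ i, ∀ x ∈ σ, r i (m i) ≤ r i x := by
  choose m hm using fun i => σ.exists_min_image (r i) hσ
  exact ⟨m, fun i => (hm i).1, fun i => (hm i).2⟩

/-- A point `y` violating dominance would lie in the upper set. As `τ` is dominant, `y` is below all
of `τ` in ranking `k`, so only `x` can be below `y` there, against maximality. -/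
theorem ScarfDominant.insert_of_maximal [DecidableEq T] {r : I → T → ℕ} {τ : Finset T} (h : ScarfDominant r τ) {k : I} {x : T}
    (hx : x ∈ scarfUpper r τ k) (hmax : ∀ y ∈ scarfUpper r τ k, r k y ≤ r k x) :
    ScarfDominant r (insert x τ) := by
  intro y
  by_contra! hy
  have hyk : y ∈ scarfUpper r τ k := by
    intro l hl
    obtain ⟨z, hz, hzl⟩ := hy l
    rcases Finset.mem_insert.1 hz with rfl | hz
    · obtain ⟨w, hw, hwl⟩ := hx l hl
      exact ⟨w, hw, hwl.trans hzl⟩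
    · exact ⟨z, hz, hzl⟩
  obtain ⟨i, hi⟩ := h y
  by_cases hik : i = k
  · subst hik
    obtain ⟨z, hz, hzl⟩ := hy i
    rcases Finset.mem_insert.1 hz with rfl | hz
    · exact absurd (hmax y hyk) (by omega)
    · exact absurd (hi z hz) (by omega)
  · obtain ⟨z, hz, hzl⟩ := hyk i hik
    exact absurd (hi z hz) (by omega)

/-- A point of the upper set exceeds `τ` somewhere in every ranking but the `k`-th, so it can only
be dominated in that one. -/
theorem ScarfDominant.le_of_mem_scarfUpper [DecidableEq T] {r : I → T → ℕ} {τ : Finset T} {k : I} {x : T}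
    (h : ScarfDominant r (insert x τ)) {y : T}
    (hy : y ∈ scarfUpper r τ k) : r k y ≤ r k x := by
  obtain ⟨i, hi⟩ := h y
  by_cases hik : i = k
  · subst hik
    exact hi x (Finset.mem_insert_self _ _)
  · obtain ⟨z, hz, hzl⟩ := hy i hik
    exact absurd (hi z (Finset.mem_insert_of_mem hz)) (by omega)

/-- A dominant set with one point less than there are rankings has two rankings with the same
minimizer. -/
theorem exists_common_minimizer [Fintype I] {r : I → T → ℕ} {τ : Finset T} (hτ : τ.Nonempty)
    (hcard : τ.card + 1 = Fintype.card I) :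
    ∃ a b : I, a ≠ b ∧ ∃ m ∈ τ, (∀ x ∈ τ, r a m ≤ r a x) ∧ ∀ x ∈ τ, r b m ≤ r b x := by
  obtain ⟨m, hm, hmin⟩ := exists_rank_minimizer r hτ
  obtain ⟨a, -, b, -, hab, he⟩ := Finset.exists_ne_map_eq_of_card_lt_of_maps_to
    (s := Finset.univ) (t := τ) (f := m) (by rw [Finset.card_univ]; omega) (fun i _ => hm i)
  exact ⟨a, b, hab, m a, hm a, hmin a, he ▸ hmin b⟩

variable {r : I → T → ℕ} {τ : Finset T} {a b : I} {m : T}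

/-- A point of `τ` in the upper set is dominated in ranking `a` only, hence equals `m`; but `m` is
also minimal in ranking `b`. -/
theorem ScarfDominant.notMem_of_mem_scarfUpper (hr : ∀ i, Function.Injective (r i))
    (h : ScarfDominant r τ) (hab : a ≠ b) (hm : m ∈ τ) (ha : ∀ x ∈ τ, r a m ≤ r a x)
    (hb : ∀ x ∈ τ, r b m ≤ r b x) {x : T} (hx : x ∈ scarfUpper r τ a) : x ∉ τ := by
  intro hxτ
  obtain ⟨i, hi⟩ := h x
  have hia : i = a := by
    by_contra hia
    obtain ⟨z, hz, hzl⟩ := hx i hia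
    exact absurd (hi z hz) (by omega)
  subst hia
  have hxm : x = m := hr i (le_antisymm (hi m hm) (ha x hxτ))
  subst hxm
  obtain ⟨z, hz, hzl⟩ := hx b hab.symm
  exact absurd (hb z hz) (by omega)

/-- The minimizers of the enlarged set exhaust it, so by counting they are distinct. The new point
minimizes exactly one ranking `k` and exceeds the minimum of `τ` in all others. -/
theorem ScarfDominant.mem_scarfUpper_or [DecidableEq T] [Fintype I] (hr : ∀ i, Function.Injective (r i))
    (hcard : τ.card + 1 = Fintype.card I) (hab : a ≠ b) (hm : m ∈ τ)
    (ha : ∀ x ∈ τ, r a m ≤ r a x) (hb : ∀ x ∈ τ, r b m ≤ r b x) {x : T} (hx : x ∉ τ)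
    (h : ScarfDominant r (insert x τ)) : x ∈ scarfUpper r τ a ∨ x ∈ scarfUpper r τ b := by
  obtain ⟨n, hn, hmin⟩ := exists_rank_minimizer r (Finset.insert_nonempty x τ)
  have hsurj := h.exists_minimizer_eq hr hn hmin
  have hinj : Function.Injective n := by
    have hsurj' : Function.Surjective (fun i => (⟨n i, hn i⟩ : {y // y ∈ insert x τ})) := by
      rintro ⟨y, hy⟩
      obtain ⟨i, hi⟩ := hsurj y hy
      exact ⟨i, Subtype.ext hi⟩
    have := (Function.Surjective.bijective_of_nat_card_le hsurj' (by
      rw [Nat.card_eq_fintype_card, Nat.card_eq_fintype_card, Fintype.card_coe,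
        Finset.card_insert_of_notMem hx, hcard])).1
    intro i j hij
    exact this (Subtype.ext hij)
  obtain ⟨k, hk⟩ := hsurj x (Finset.mem_insert_self _ _)
  have hne : ∀ l, l ≠ k → n l ∈ τ := fun l hl =>
    (Finset.mem_insert.1 (hn l)).resolve_left fun e => hl (hinj (e.trans hk.symm))
  have hxk : x ∈ scarfUpper r τ k := by
    intro l hl
    refine ⟨n l, hne l hl, lt_of_le_of_ne (hmin l x (Finset.mem_insert_self _ _)) fun e => ?_⟩
    have := hr l e
    exact hx (this ▸ hne l hl)
  by_cases hka : a = k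
  · exact Or.inl (hka ▸ hxk)
  by_cases hkb : b = k
  · exact Or.inr (hkb ▸ hxk)
  -- If `k` were neither `a` nor `b`, both of these rankings would keep the minimizer `m`.
  exfalso
  have h1 : n a = m := hr a (le_antisymm (hmin a m (Finset.mem_insert_of_mem hm))
    (ha _ (hne a hka)))
  have h2 : n b = m := hr b (le_antisymm (hmin b m (Finset.mem_insert_of_mem hm))
    (hb _ (hne b hkb)))
  exact hab (hinj (h1.trans h2.symm))

theorem ScarfDominant.disjoint_scarfUpper (h : ScarfDominant r τ) (hab : a ≠ b) :
    Disjoint (scarfUpper r τ a) (scarfUpper r τ b) := by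
  rw [Set.disjoint_left]
  intro x hxa hxb
  obtain ⟨i, hi⟩ := h x
  obtain ⟨z, hz, hzl⟩ : ∃ z ∈ τ, r i z < r i x := by
    by_cases hia : i = a
    · exact hxb i (hia ▸ hab)
    · exact hxa i hia
  exact absurd (hi z hz) (by omega)

theorem exists_maximal_scarfUpper [Finite T] {k : I} (hne : (scarfUpper r τ k).Nonempty) :
    ∃ x ∈ scarfUpper r τ k, ∀ y ∈ scarfUpper r τ k, r k y ≤ r k x :=
  Set.exists_max_image _ (r k) (Set.toFinite _) hne

variable [Fintype I]

/-- The dominant sets with as many points as there are rankings that contain a given set. -/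
def scarfRooms (r : I → T → ℕ) (τ : Finset T) : Set (Finset T) :=
  {σ | τ ⊆ σ ∧ ScarfDominant r σ ∧ σ.card = Fintype.card I}

theorem mem_scarfRooms_iff [DecidableEq T] (hcard : τ.card + 1 = Fintype.card I) {σ : Finset T} :
    σ ∈ scarfRooms r τ ↔ ∃ x, x ∉ τ ∧ ScarfDominant r (insert x τ) ∧ σ = insert x τ := by
  constructor
  · rintro ⟨h1, h2, h3⟩
    obtain ⟨x, hx⟩ : ∃ x, σ \ τ = {x} := by
      rw [← Finset.card_eq_one, Finset.card_sdiff_of_subset h1]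
      omega
    have hx' : x ∈ σ \ τ := hx ▸ Finset.mem_singleton_self x
    have e : insert x τ = σ := by
      rw [Finset.insert_eq, ← hx, Finset.sdiff_union_of_subset h1]
    exact ⟨x, (Finset.mem_sdiff.1 hx').2, e ▸ h2, e.symm⟩
  · rintro ⟨x, hx, h, rfl⟩
    exact ⟨Finset.subset_insert _ _, h, by rw [Finset.card_insert_of_notMem hx, hcard]⟩

/-- Each of the two disjoint upper sets contributes exactly one completing point, its maximum in the
corresponding ranking. -/
theorem ncard_scarfRooms_eq_two [Finite T] (hr : ∀ i, Function.Injective (r i)) (h : ScarfDominant r τ)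
    (hcard : τ.card + 1 = Fintype.card I) (hab : a ≠ b) (hm : m ∈ τ)
    (ha : ∀ x ∈ τ, r a m ≤ r a x) (hb : ∀ x ∈ τ, r b m ≤ r b x)
    (hna : (scarfUpper r τ a).Nonempty) (hnb : (scarfUpper r τ b).Nonempty) :
    (scarfRooms r τ).ncard = 2 := by
  classical
  obtain ⟨x, hx, hxm⟩ := exists_maximal_scarfUpper hna
  obtain ⟨y, hy, hym⟩ := exists_maximal_scarfUpper hnb
  have hxτ := h.notMem_of_mem_scarfUpper hr hab hm ha hb hx
  have hyτ := h.notMem_of_mem_scarfUpper hr hab.symm hm hb ha hy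
  refine Set.ncard_eq_two.2 ⟨insert x τ, insert y τ, fun e => ?_, ?_⟩
  · have : x ∈ insert y τ := e ▸ Finset.mem_insert_self x τ
    rcases Finset.mem_insert.1 this with rfl | h'
    · exact Set.disjoint_left.1 (h.disjoint_scarfUpper hab) hx hy
    · exact hxτ h'
  · ext σ
    rw [mem_scarfRooms_iff hcard]
    constructor
    · rintro ⟨z, hz, hd, rfl⟩
      rcases hd.mem_scarfUpper_or hr hcard hab hm ha hb hz with hz' | hz'
      · exact Or.inl (by rw [hr a (le_antisymm (hxm z hz') (hd.le_of_mem_scarfUpper hx))])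
      · exact Or.inr (by
          rw [hr b (le_antisymm (hym z hz') (hd.le_of_mem_scarfUpper hy)),
            Set.mem_singleton_iff])
    · rintro (rfl | rfl)
      · exact ⟨x, hxτ, h.insert_of_maximal hx hxm, rfl⟩
      · exact ⟨y, hyτ, h.insert_of_maximal hy hym, rfl⟩

theorem ncard_scarfRooms_eq_one [Finite T] (hr : ∀ i, Function.Injective (r i)) (h : ScarfDominant r τ)
    (hcard : τ.card + 1 = Fintype.card I) (hab : a ≠ b) (hm : m ∈ τ)
    (ha : ∀ x ∈ τ, r a m ≤ r a x) (hb : ∀ x ∈ τ, r b m ≤ r b x)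
    (hna : (scarfUpper r τ a).Nonempty) (hnb : scarfUpper r τ b = ∅) :
    (scarfRooms r τ).ncard = 1 := by
  classical
  obtain ⟨x, hx, hxm⟩ := exists_maximal_scarfUpper hna
  have hxτ := h.notMem_of_mem_scarfUpper hr hab hm ha hb hx
  refine Set.ncard_eq_one.2 ⟨insert x τ, ?_⟩
  ext σ
  rw [mem_scarfRooms_iff hcard, Set.mem_singleton_iff]
  constructor
  · rintro ⟨z, hz, hd, rfl⟩
    rcases hd.mem_scarfUpper_or hr hcard hab hm ha hb hz with hz' | hz'
    · rw [hr a (le_antisymm (hxm z hz') (hd.le_of_mem_scarfUpper hx))]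
    · simp [hnb] at hz'
  · rintro rfl
    exact ⟨x, hxτ, h.insert_of_maximal hx hxm, rfl⟩

/-- Among the facets of a set with `|I|` points, the number of those coloured by all colours but
`i₀` is odd if the set has all colours, and even otherwise. -/
theorem odd_ncard_almost_colourful [DecidableEq I] {c : T → I} {i₀ : I} {σ : Finset T}
    (hσ : σ.card = Fintype.card I) :
    (σ.image c = Finset.univ →
      {τ : Finset T | τ ⊆ σ ∧ τ.card + 1 = Fintype.card I ∧
        τ.image c = Finset.univ.erase i₀}.ncard = 1) ∧
    (σ.image c ≠ Finset.univ →
      Even {τ : Finset T | τ ⊆ σ ∧ τ.card + 1 = Fintype.card I ∧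
        τ.image c = Finset.univ.erase i₀}.ncard) := by
  classical
  have hIpos : 0 < Fintype.card I := Fintype.card_pos_iff.2 ⟨i₀⟩
  have hform : ∀ τ : Finset T, (τ ⊆ σ ∧ τ.card + 1 = Fintype.card I ∧
      τ.image c = Finset.univ.erase i₀) ↔
      ∃ x ∈ σ, τ = σ.erase x ∧ (σ.erase x).image c = Finset.univ.erase i₀ := by
    intro τ
    constructor
    · rintro ⟨h1, h2, h3⟩
      obtain ⟨x, hx⟩ : ∃ x, σ \ τ = {x} := by
        rw [← Finset.card_eq_one, Finset.card_sdiff_of_subset h1]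
        omega
      have hx' : x ∈ σ \ τ := hx ▸ Finset.mem_singleton_self x
      have e : τ = σ.erase x := by
        rw [Finset.erase_eq, ← hx, Finset.sdiff_sdiff_eq_self h1]
      exact ⟨x, (Finset.mem_sdiff.1 hx').1, e, e ▸ h3⟩
    · rintro ⟨x, hx, rfl, h⟩
      exact ⟨Finset.erase_subset _ _, by rw [Finset.card_erase_of_mem hx]; omega, h⟩
  have hinjOn : ∀ x ∈ σ, (σ.erase x).image c = Finset.univ.erase i₀ →
      Set.InjOn c (σ.erase x) := by
    intro x hx h
    rw [← Finset.card_image_iff, h, Finset.card_erase_of_mem (Finset.mem_univ _),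
      Finset.card_erase_of_mem hx, hσ, Finset.card_univ]
  constructor
  · intro him
    have hinj : Set.InjOn c σ := by
      rw [← Finset.card_image_iff, him, hσ, Finset.card_univ]
    obtain ⟨x, hx, hxi⟩ := Finset.mem_image.1 (him ▸ Finset.mem_univ i₀ : i₀ ∈ σ.image c)
    refine Set.ncard_eq_one.2 ⟨σ.erase x, ?_⟩
    ext τ
    rw [Set.mem_ofPred_eq, hform, Set.mem_singleton_iff]
    constructor
    · rintro ⟨y, hy, rfl, h⟩
      have : x = y := by
        by_contra hxy
        have : c x ∈ (σ.erase y).image c :=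
          Finset.mem_image_of_mem c (Finset.mem_erase.2 ⟨hxy, hx⟩)
        rw [h, hxi] at this
        simp at this
      rw [this]
    · rintro rfl
      refine ⟨x, hx, rfl, ?_⟩
      ext i
      simp only [Finset.mem_image, Finset.mem_erase, Finset.mem_univ, and_true]
      constructor
      · rintro ⟨y, ⟨hyx, hy⟩, rfl⟩ e
        exact hyx (hinj hy hx (e.trans hxi.symm))
      · intro hi
        obtain ⟨y, hy, hyi⟩ := Finset.mem_image.1 (him ▸ Finset.mem_univ i : i ∈ σ.image c)
        exact ⟨y, ⟨fun e => hi (by rw [← hyi, e, hxi]), hy⟩, hyi⟩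
  · intro him
    by_cases hemp : ∃ x ∈ σ, (σ.erase x).image c = Finset.univ.erase i₀
    · obtain ⟨x, hx, h⟩ := hemp
      have hcx : c x ≠ i₀ := by
        intro e
        apply him
        rw [← Finset.insert_erase hx, Finset.image_insert, h, e,
          Finset.insert_erase (Finset.mem_univ _)]
      -- The only repeated colour is that of `x` and `y`. Removing either gives a door; removing
      -- another point keeps both, whereas a door is injectively coloured.
      obtain ⟨y, hy, hyx⟩ := Finset.mem_image.1
        (h ▸ Finset.mem_erase.2 ⟨hcx, Finset.mem_univ _⟩ : c x ∈ (σ.erase x).image c)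
      rw [Finset.mem_erase] at hy
      have hinj := hinjOn x hx h
      have hy' : (σ.erase y).image c = Finset.univ.erase i₀ := by
        rw [← h]
        have e1 : insert y ((σ.erase x).erase y) = σ.erase x :=
          Finset.insert_erase (Finset.mem_erase.2 hy)
        have e2 : insert x ((σ.erase y).erase x) = σ.erase y :=
          Finset.insert_erase (Finset.mem_erase.2 ⟨hy.1.symm, hx⟩)
        rw [← e1, ← e2, Finset.image_insert, Finset.image_insert, hyx, Finset.erase_right_comm]
      have : {τ : Finset T | τ ⊆ σ ∧ τ.card + 1 = Fintype.card I ∧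
          τ.image c = Finset.univ.erase i₀}.ncard = 2 := by
        refine Set.ncard_eq_two.2 ⟨σ.erase x, σ.erase y, fun e => ?_, ?_⟩
        · have : y ∈ σ.erase y := e ▸ Finset.mem_erase.2 hy
          simp at this
        · ext τ
          rw [Set.mem_ofPred_eq, hform]
          constructor
          · rintro ⟨z, hz, rfl, hz'⟩
            by_cases hzx : z = x
            · exact Or.inl (by rw [hzx])
            by_cases hzy : z = y
            · exact Or.inr (by rw [hzy, Set.mem_singleton_iff])
            · exact absurd (hinjOn z hz hz' (Finset.mem_erase.2 ⟨Ne.symm hzy, hy.2⟩)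
                (Finset.mem_erase.2 ⟨Ne.symm hzx, hx⟩) hyx) hy.1
          · rintro (rfl | rfl)
            · exact ⟨x, hx, rfl, h⟩
            · exact ⟨y, hy.2, rfl, hy'⟩
      rw [this]
      exact even_two
    · have : {τ : Finset T | τ ⊆ σ ∧ τ.card + 1 = Fintype.card I ∧
          τ.image c = Finset.univ.erase i₀} = ∅ := by
        ext τ
        rw [Set.mem_ofPred_eq, hform]
        simp only [Set.mem_empty_iff_false, iff_false]
        rintro ⟨x, hx, -, h⟩
        exact hemp ⟨x, hx, h⟩
      rw [this, Set.ncard_empty]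
      exact Even.zero

/-- **Scarf's lemma** for rankings with slack points `v i`: there is a dominant set that has every
colour exactly once. -/
theorem exists_colourful_scarfDominant [Finite T] [DecidableEq I] [Nontrivial I] (hr : ∀ i, Function.Injective (r i))
    {v : I → T} (hvmin : ∀ i y, r i (v i) ≤ r i y)
    (hvmax : ∀ i j, i ≠ j → ∀ y ∉ Set.range v, r i y < r i (v j))
    {c : T → I} (hc : ∀ i, c (v i) = i) :
    ∃ σ : Finset T, ScarfDominant r σ ∧ σ.card = Fintype.card I ∧ σ.image c = Finset.univ := by
  classical
  have := Fintype.ofFinite T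
  obtain ⟨i₀, j₀, hij⟩ := exists_pair_ne I
  have hvinj : Function.Injective v := Function.LeftInverse.injective hc
  set τ₀ : Finset T := (Finset.univ.erase i₀).image v with hτ₀
  have hτ₀mem : ∀ i, i ≠ i₀ → v i ∈ τ₀ := fun i hi =>
    Finset.mem_image_of_mem _ (Finset.mem_erase.2 ⟨hi, Finset.mem_univ _⟩)
  have hcard₀ : τ₀.card + 1 = Fintype.card I := by
    rw [Finset.card_image_of_injective _ hvinj, Finset.card_erase_of_mem (Finset.mem_univ _),
      Finset.card_univ]
    have := Fintype.card_pos_iff.2 ⟨i₀⟩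
    omega
  have hne₀ : τ₀.Nonempty := ⟨_, hτ₀mem j₀ hij.symm⟩
  have him₀ : τ₀.image c = Finset.univ.erase i₀ := by
    rw [hτ₀, Finset.image_image]
    simp [Function.comp_def, hc]
  have hdom₀ : ScarfDominant r τ₀ := by
    intro y
    by_cases hy : y ∈ Set.range v
    · obtain ⟨k, rfl⟩ := hy
      exact ⟨k, fun x _ => hvmin k x⟩
    · refine ⟨i₀, fun x hx => ?_⟩
      obtain ⟨k, hk, rfl⟩ := Finset.mem_image.1 hx
      exact (hvmax i₀ k (Finset.ne_of_mem_erase hk).symm y hy).le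
  -- Incidences between doors (dominant, coloured by all colours but `i₀`) and rooms are counted in
  -- two ways; only the door `τ₀` lies in an odd number of rooms.
  let doors : Finset (Finset T) := Finset.univ.filter fun τ =>
    ScarfDominant r τ ∧ τ.card + 1 = Fintype.card I ∧ τ.image c = Finset.univ.erase i₀
  let rooms : Finset (Finset T) := Finset.univ.filter fun σ =>
    ScarfDominant r σ ∧ σ.card = Fintype.card I
  have hcount := Finset.sum_card_bipartiteAbove_eq_sum_card_bipartiteBelow
    (s := doors) (t := rooms) (fun τ σ => τ ⊆ σ)
  have habove : ∀ τ, (rooms.bipartiteAbove (fun τ σ => τ ⊆ σ) τ).card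
      = (scarfRooms r τ).ncard := by
    intro τ
    rw [← Set.ncard_coe_finset]
    congr 1
    ext σ
    simp [rooms, Finset.bipartiteAbove, scarfRooms, and_comm]
  have hbelow : ∀ σ ∈ rooms, (doors.bipartiteBelow (fun τ σ => τ ⊆ σ) σ).card
      = {τ : Finset T | τ ⊆ σ ∧ τ.card + 1 = Fintype.card I ∧
        τ.image c = Finset.univ.erase i₀}.ncard := by
    intro σ hσ
    rw [← Set.ncard_coe_finset]
    congr 1
    ext τ
    simp only [rooms, Finset.mem_filter, Finset.mem_univ, true_and] at hσ
    simp only [doors, Finset.bipartiteBelow, Finset.coe_filter, Finset.mem_filter,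
      Finset.mem_univ, true_and, Set.mem_ofPred_eq]
    exact ⟨fun h => ⟨h.2, h.1.2⟩, fun h => ⟨⟨hσ.1.mono h.1, h.2⟩, h.1⟩⟩
  have hodd : ∀ τ ∈ doors, Odd (rooms.bipartiteAbove (fun τ σ => τ ⊆ σ) τ).card ↔ τ = τ₀ := by
    intro τ hτ
    rw [habove]
    simp only [doors, Finset.mem_filter, Finset.mem_univ, true_and] at hτ
    obtain ⟨hd, hcd, him⟩ := hτ
    by_cases hτ' : τ = τ₀
    · subst hτ'
      refine iff_of_true ?_ rfl
      obtain ⟨m, hm, hmin⟩ := τ₀.exists_min_image (r i₀) hne₀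
      obtain ⟨j, hj, rfl⟩ := Finset.mem_image.1 hm
      have hji : j ≠ i₀ := Finset.ne_of_mem_erase hj
      -- The slack point `v j` minimizes both rankings `i₀` and `j` on `τ₀`. The upper set of `i₀`
      -- contains `v i₀`; that of `j` is empty, as no non-slack point exceeds `v j` in ranking `i₀`.
      rw [ncard_scarfRooms_eq_one hr hd hcd hji.symm hm hmin (fun x _ => hvmin j x)]
      · exact odd_one
      · refine ⟨v i₀, fun l hl => ⟨v l, hτ₀mem l hl, ?_⟩⟩
        exact lt_of_le_of_ne (hvmin l _) fun e => hl (hvinj (hr l e))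
      · ext y
        simp only [Set.mem_empty_iff_false, iff_false]
        intro hy
        obtain ⟨z, hz, hzl⟩ := hy i₀ hji.symm
        by_cases hyv : y ∈ Set.range v
        · obtain ⟨k, rfl⟩ := hyv
          by_cases hkj : k = j
          · subst hkj
            exact absurd (hmin z hz) (by omega)
          · obtain ⟨w, hw, hwl⟩ := hy k hkj
            exact absurd (hvmin k w) (by omega)
        · have := hvmax i₀ j hji.symm y hyv
          have := hmin z hz
          omega
    · refine iff_of_false ?_ hτ'
      have hne : τ.Nonempty := by
        rw [← Finset.image_nonempty (f := c), him]
        exact ⟨j₀, Finset.mem_erase.2 ⟨hij.symm, Finset.mem_univ _⟩⟩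
      -- Otherwise all of `τ` is at least as high as a slack point `v k` in some ranking `l ≠ k`.
      -- Then `τ` consists of slack points, and its colours force `τ = τ₀`.
      have hup : ∀ k, v k ∈ scarfUpper r τ k := by
        intro k l hl
        by_contra! hcon
        apply hτ'
        have hsub : ∀ x ∈ τ, ∃ j, v j = x := by
          intro x hx
          by_contra hxv
          exact absurd (hvmax l k hl x hxv) (by have := hcon x hx; omega)
        ext x
        constructor
        · intro hx
          obtain ⟨j, rfl⟩ := hsub x hx
          apply hτ₀mem
          have : c (v j) ∈ τ.image c := Finset.mem_image_of_mem c hx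
          rw [him, hc] at this
          exact Finset.ne_of_mem_erase this
        · intro hx
          obtain ⟨j, hj, rfl⟩ := Finset.mem_image.1 hx
          rw [← him] at hj
          obtain ⟨y, hy, rfl⟩ := Finset.mem_image.1 hj
          obtain ⟨k', rfl⟩ := hsub y hy
          rwa [hc]
      obtain ⟨a, b, hab, m, hm, ha, hb⟩ := exists_common_minimizer (r := r) hne hcd
      rw [ncard_scarfRooms_eq_two hr hd hcd hab hm ha hb ⟨_, hup a⟩ ⟨_, hup b⟩]
      decide
  by_contra! hcon
  have h1 : Odd (∑ τ ∈ doors, (rooms.bipartiteAbove (fun τ σ => τ ⊆ σ) τ).card) := by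
    rw [Finset.odd_sum_iff_odd_card_odd]
    have : {τ ∈ doors | Odd (rooms.bipartiteAbove (fun τ σ => τ ⊆ σ) τ).card} = {τ₀} := by
      ext τ
      rw [Finset.mem_filter, Finset.mem_singleton]
      constructor
      · rintro ⟨h, h'⟩
        exact (hodd τ h).1 h'
      · rintro rfl
        have : τ₀ ∈ doors := by
          simp only [doors, Finset.mem_filter, Finset.mem_univ, true_and]
          exact ⟨hdom₀, hcard₀, him₀⟩
        exact ⟨this, (hodd _ this).2 rfl⟩
    rw [this, Finset.card_singleton]
    exact odd_one
  rw [hcount] at h1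
  refine (Nat.not_odd_iff_even.2 ?_) h1
  refine Finset.even_sum _ fun σ hσ => ?_
  rw [hbelow σ hσ]
  simp only [rooms, Finset.mem_filter, Finset.mem_univ, true_and] at hσ
  exact (odd_ncard_almost_colourful hσ.2).2 (hcon σ hσ.1 hσ.2)

end Scarf

/-! ### Brouwer's fixed point theorem for the standard simplex -/

section Brouwer

open Filter Topology

variable {I : Type*} [Fintype I]

/-- The lattice points with coordinate sum `N` of the `N`-fold dilated standard simplex. -/
abbrev LatticeSimplex (I : Type*) [Fintype I] (N : ℕ) : Type _ :=
  {x : I → Fin (N + 1) // ∑ i, (x i : ℕ) = N}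

namespace LatticeSimplex

variable {N : ℕ}

/-- The point of the standard simplex that corresponds to a lattice point. -/
noncomputable def toReal (x : LatticeSimplex I N) : I → ℝ := fun i => (x.1 i : ℕ) / N

theorem toReal_mem (hN : 0 < N) (x : LatticeSimplex I N) : x.toReal ∈ stdSimplex ℝ I := by
  refine ⟨fun i => by unfold toReal; positivity, ?_⟩
  have h : (∑ i, ((x.1 i : ℕ) : ℝ)) = N := by exact_mod_cast x.2
  have : (N : ℝ) ≠ 0 := by positivity
  simp only [toReal]
  rw [← Finset.sum_div, h, div_self this]

theorem exists_ge [Nonempty I] {w : I → ℕ} (hw : ∑ i, w i ≤ N) :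
    ∃ y : LatticeSimplex I N, ∀ i, w i ≤ y.1 i := by
  classical
  obtain ⟨i₁⟩ := ‹Nonempty I›
  set y : I → ℕ := fun i => w i + (Pi.single i₁ (N - ∑ i, w i) : I → ℕ) i with hy
  have hsum : ∑ i, y i = N := by
    rw [hy, Finset.sum_add_distrib, Finset.sum_pi_single']
    simp only [Finset.mem_univ, if_true]
    omega
  have hlt : ∀ i, y i < N + 1 := fun i =>
    Nat.lt_succ_of_le (hsum ▸ Finset.single_le_sum (fun j _ => Nat.zero_le (y j))
      (Finset.mem_univ i))
  exact ⟨⟨fun i => ⟨y i, hlt i⟩, hsum⟩, fun i => Nat.le_add_right _ _⟩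

/-- Rankings of the lattice points and of slack points, one for each coordinate; ties are broken by
an enumeration. -/
noncomputable def rank [DecidableEq I] (i : I) : LatticeSimplex I N ⊕ I → ℕ
  | .inl x => 1 + (x.1 i : ℕ) * Fintype.card (LatticeSimplex I N) + Fintype.equivFin _ x
  | .inr j => if j = i then 0
      else 1 + (N + 1) * Fintype.card (LatticeSimplex I N) + Fintype.equivFin I j

variable [DecidableEq I]

theorem rank_inl_lt (i : I) (x : LatticeSimplex I N) :
    rank i (.inl x) < 1 + (N + 1) * Fintype.card (LatticeSimplex I N) := by
  have h1 := (Fintype.equivFin (LatticeSimplex I N) x).2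
  have h2 : (x.1 i : ℕ) ≤ N := Nat.le_of_lt_succ (x.1 i).2
  have h3 := Nat.mul_le_mul_right (Fintype.card (LatticeSimplex I N)) h2
  simp only [rank]
  rw [add_mul]
  omega

theorem rank_inl_pos (i : I) (x : LatticeSimplex I N) : 0 < rank i (.inl x) := by
  simp only [rank]
  omega

theorem rank_inr_self (i : I) : rank (N := N) i (.inr i) = 0 := by simp [rank]

theorem rank_inr_of_ne {i j : I} (h : j ≠ i) : rank (N := N) i (.inr j)
    = 1 + (N + 1) * Fintype.card (LatticeSimplex I N) + Fintype.equivFin I j := by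
  simp [rank, h]

/-- The tie-breaker is smaller than the factor multiplying the coordinate, so the coordinate
decides. -/
theorem coord_le_of_rank_le {i : I} {x y : LatticeSimplex I N}
    (h : rank i (.inl x) ≤ rank i (.inl y)) : (x.1 i : ℕ) ≤ y.1 i := by
  by_contra! hlt
  have h1 := (Fintype.equivFin (LatticeSimplex I N) y).2
  have h3 := Nat.mul_le_mul_right (Fintype.card (LatticeSimplex I N)) (Nat.succ_le_of_lt hlt)
  simp only [rank] at h
  rw [Nat.succ_mul] at h3
  omega

theorem rank_injective (i : I) : Function.Injective (rank (N := N) i) := by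
  rintro (x | j) (y | k) h
  · have h1 := le_antisymm (coord_le_of_rank_le h.le) (coord_le_of_rank_le h.ge)
    simp only [rank, h1] at h
    congr 1
    exact (Fintype.equivFin _).injective (Fin.ext (by omega))
  · exfalso
    have h1 := rank_inl_pos i x
    have h2 := rank_inl_lt i x
    by_cases hk : k = i
    · rw [hk, rank_inr_self] at h
      omega
    · rw [rank_inr_of_ne hk] at h
      omega
  · exfalso
    have h1 := rank_inl_pos i y
    have h2 := rank_inl_lt i y
    by_cases hk : j = i
    · rw [hk, rank_inr_self] at h
      omega
    · rw [rank_inr_of_ne hk] at h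
      omega
  · congr 1
    by_cases hj : j = i <;> by_cases hk : k = i
    · rw [hj, hk]
    · rw [hj, rank_inr_self, rank_inr_of_ne hk] at h
      omega
    · rw [hk, rank_inr_self, rank_inr_of_ne hj] at h
      omega
    · rw [rank_inr_of_ne hj, rank_inr_of_ne hk] at h
      exact (Fintype.equivFin _).injective (Fin.ext (by omega))

end LatticeSimplex

open LatticeSimplex

theorem exists_le_of_mem_stdSimplex {x y : I → ℝ} (hx : x ∈ stdSimplex ℝ I)
    (hy : y ∈ stdSimplex ℝ I) : ∃ i, x i ≤ y i := by
  by_contra! h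
  have hne : (Finset.univ : Finset I).Nonempty := by
    rw [Finset.nonempty_iff_ne_empty]
    intro e
    have := hx.2
    simp [e] at this
  have := Finset.sum_lt_sum_of_nonempty hne fun i _ => h i
  rw [hx.2, hy.2] at this
  exact lt_irrefl _ this

/-- Approximate form of Brouwer's fixed point theorem: there are points of the simplex close to
each other, one for each coordinate, at which the map almost does not decrease the coordinate. -/
theorem exists_almost_fixedPoint [Nontrivial I] {f : (I → ℝ) → I → ℝ}
    (hf : Set.MapsTo f (stdSimplex ℝ I) (stdSimplex ℝ I)) {N : ℕ} (hN : 0 < N) :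
    ∃ x ∈ stdSimplex ℝ I, ∀ i, ∃ y ∈ stdSimplex ℝ I,
      (∀ j, |y j - x j| ≤ Fintype.card I / N) ∧ y i - Fintype.card I / N ≤ f y i := by
  classical
  have hN' : (0 : ℝ) < N := by exact_mod_cast hN
  -- The colour of a lattice point is a coordinate that `f` does not decrease there.
  choose c₀ hc₀ using fun x : LatticeSimplex I N =>
    exists_le_of_mem_stdSimplex (x.toReal_mem hN) (hf (x.toReal_mem hN))
  obtain ⟨σ, hσ, -, him⟩ := exists_colourful_scarfDominant (r := rank (I := I) (N := N))
    rank_injective (v := Sum.inr)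
    (fun i y => by rw [rank_inr_self]; exact Nat.zero_le _)
    (by
      rintro i j hij (y | k) hy
      · rw [rank_inr_of_ne hij.symm]
        have := rank_inl_lt i y
        omega
      · exact absurd ⟨k, rfl⟩ hy)
    (c := Sum.elim c₀ id) (fun i => rfl)
  have hcol : ∀ i, Sum.inr i ∉ σ → ∃ x, Sum.inl x ∈ σ ∧ c₀ x = i := by
    intro i hi
    obtain ⟨x | j, hx, hxi⟩ := Finset.mem_image.1 (him ▸ Finset.mem_univ i)
    · exact ⟨x, hx, hxi⟩
    · exact absurd ((show j = i from hxi) ▸ hx) hi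
  -- A ranking that dominates a lattice point cannot have its own slack point in `σ`, since that
  -- point has rank zero.
  have hdom : ∀ y : LatticeSimplex I N, ∃ i, Sum.inr i ∉ σ ∧
      ∀ x, Sum.inl x ∈ σ → (y.1 i : ℕ) ≤ x.1 i := by
    intro y
    obtain ⟨i, hi⟩ := hσ (Sum.inl y)
    refine ⟨i, fun hmem => ?_, fun x hx => coord_le_of_rank_le (hi _ hx)⟩
    have h1 := hi _ hmem
    have h2 := rank_inl_pos i y
    rw [rank_inr_self] at h1
    omega
  obtain ⟨x₀, hx₀⟩ : ∃ x, Sum.inl x ∈ σ := by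
    obtain ⟨y, -⟩ := LatticeSimplex.exists_ge (I := I) (N := N) (w := 0) (by simp)
    obtain ⟨i, hi, -⟩ := hdom y
    obtain ⟨x, hx, -⟩ := hcol i hi
    exact ⟨x, hx⟩
  have hmin : ∀ i, ∃ p : LatticeSimplex I N, Sum.inl p ∈ σ ∧
      ∀ x : LatticeSimplex I N, Sum.inl x ∈ σ → (p.1 i : ℕ) ≤ x.1 i := fun i =>
    Set.exists_min_image {x | Sum.inl x ∈ σ} (fun x : LatticeSimplex I N => (x.1 i : ℕ))
      (Set.toFinite _) ⟨x₀, hx₀⟩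
  choose p hp hpmin using hmin
  set m : I → ℕ := fun i => if Sum.inr i ∈ σ then 0 else (p i).1 i with hm
  have hmle : ∀ x, Sum.inl x ∈ σ → ∀ i, m i ≤ x.1 i := by
    intro x hx i
    simp only [hm]
    split_ifs
    · exact Nat.zero_le _
    · exact hpmin i x hx
  -- Otherwise there is room for a lattice point exceeding every `m i`, against dominance. Hence the
  -- nonnegative excesses over `m` sum to less than `|I|`, and the lattice points of `σ` are close
  -- together.
  have hsum : N < ∑ i, m i + Fintype.card I := by
    by_contra! hcon
    obtain ⟨y, hy⟩ := LatticeSimplex.exists_ge (I := I) (N := N) (w := fun i => m i + 1) (by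
      rw [Finset.sum_add_distrib]
      simpa using hcon)
    obtain ⟨i, hi, hle⟩ := hdom y
    have h1 := hy i
    have h2 := hle _ (hp i)
    simp only [hm, if_neg hi] at h1
    omega
  have hclose : ∀ x, Sum.inl x ∈ σ → ∀ i, (x.1 i : ℕ) ≤ m i + Fintype.card I := by
    intro x hx i
    have h1 : ((x.1 i : ℕ) : ℤ) - m i ≤ ∑ j, (((x.1 j : ℕ) : ℤ) - m j) :=
      Finset.single_le_sum (f := fun j => ((x.1 j : ℕ) : ℤ) - m j)
        (fun j _ => sub_nonneg.2 (by exact_mod_cast hmle x hx j)) (Finset.mem_univ i)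
    rw [Finset.sum_sub_distrib] at h1
    have h2 : ∑ j, ((x.1 j : ℕ) : ℤ) = N := by exact_mod_cast x.2
    have h3 : (N : ℤ) < ∑ j, (m j : ℤ) + Fintype.card I := by exact_mod_cast hsum
    rw [h2] at h1
    omega
  have hdist : ∀ x y, Sum.inl x ∈ σ → Sum.inl y ∈ σ → ∀ j,
      y.toReal j - x.toReal j ≤ Fintype.card I / N := by
    intro x y hx hy j
    simp only [toReal]
    rw [← sub_div]
    gcongr
    have h1 : (y.1 j : ℕ) ≤ x.1 j + Fintype.card I :=
      (hclose y hy j).trans (Nat.add_le_add_right (hmle x hx j) _)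
    rw [sub_le_iff_le_add']
    exact_mod_cast h1
  have habs : ∀ x y, Sum.inl x ∈ σ → Sum.inl y ∈ σ → ∀ j,
      |y.toReal j - x.toReal j| ≤ Fintype.card I / N := fun x y hx hy j =>
    abs_sub_le_iff.2 ⟨hdist x y hx hy j, hdist y x hy hx j⟩
  refine ⟨x₀.toReal, x₀.toReal_mem hN, fun i => ?_⟩
  -- If the slack point `i` replaces a lattice point of colour `i`, then `m i = 0`, so the `i`-th
  -- coordinate is at most `|I| / N` and the inequality is trivial.
  by_cases hi : Sum.inr i ∈ σ
  · refine ⟨x₀.toReal, x₀.toReal_mem hN, habs x₀ x₀ hx₀ hx₀, ?_⟩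
    have h1 := hclose x₀ hx₀ i
    simp only [hm, if_pos hi, zero_add] at h1
    refine le_trans ?_ ((hf (x₀.toReal_mem hN)).1 i)
    rw [sub_nonpos]
    simp only [toReal]
    gcongr
  · obtain ⟨x, hx, rfl⟩ := hcol i hi
    refine ⟨x.toReal, x.toReal_mem hN, habs x₀ x hx₀ hx, le_trans ?_ (hc₀ x)⟩
    have : (0 : ℝ) ≤ Fintype.card I / N := by positivity
    linarith

/-- **Brouwer's fixed point theorem** for the standard simplex. -/
theorem exists_fixedPoint_stdSimplex [Nontrivial I] {f : (I → ℝ) → I → ℝ}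
    (hf : Set.MapsTo f (stdSimplex ℝ I) (stdSimplex ℝ I))
    (hcont : ContinuousOn f (stdSimplex ℝ I)) : ∃ z ∈ stdSimplex ℝ I, f z = z := by
  choose x hx y hy hyx hyf using fun k : ℕ => exists_almost_fixedPoint hf (Nat.succ_pos k)
  obtain ⟨z, hz, φ, hφ, hlim⟩ := (isCompact_stdSimplex ℝ I).tendsto_subseq hx
  have herr : Tendsto (fun k : ℕ => (Fintype.card I : ℝ) / (φ k + 1 : ℕ)) atTop (𝓝 0) :=
    ((tendsto_const_div_atTop_nhds_zero_nat (Fintype.card I : ℝ)).comp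
      (tendsto_add_atTop_nat 1)).comp hφ.tendsto_atTop
  have hylim : ∀ i, Tendsto (fun k => y (φ k) i) atTop (𝓝 z) := by
    intro i
    rw [tendsto_pi_nhds]
    intro j
    have h1 : Tendsto (fun k => y (φ k) i j - x (φ k) j) atTop (𝓝 0) :=
      squeeze_zero_norm (fun k => hyx (φ k) i j) herr
    have h2 := h1.add ((tendsto_pi_nhds.1 hlim) j)
    simpa using h2
  have hle : ∀ i, z i ≤ f z i := by
    intro i
    have h1 : Tendsto (fun k => f (y (φ k) i)) atTop (𝓝 (f z)) :=
      (hcont z hz).tendsto.comp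
        (tendsto_nhdsWithin_iff.2 ⟨hylim i, Eventually.of_forall fun k => hy (φ k) i⟩)
    have h2 := ((tendsto_pi_nhds.1 (hylim i)) i).sub herr
    rw [sub_zero] at h2
    exact le_of_tendsto_of_tendsto' h2 ((tendsto_pi_nhds.1 h1) i) fun k => hyf (φ k) i
  refine ⟨z, hz, funext fun i => ?_⟩
  -- Both sides have coordinate sum one, so no inequality is strict.
  have := (Finset.sum_eq_sum_iff_of_le fun i (_ : i ∈ Finset.univ) => hle i).1
    (hz.2.trans (hf hz).2.symm)
  exact (this i (Finset.mem_univ i)).symm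

end Brouwer

namespace Squeezing

open Geometry Set

/-! ### Inradius, shrunken copies and squeezing of one simplex -/

section SimplexGeometry

variable {E : Type*} [NormedAddCommGroup E] [NormedSpace ℝ E] {s : Finset E} {ε : ℝ}

theorem isCompact_simplex (s : Finset E) : IsCompact (simplex s) :=
  s.finite_toSet.isCompact_convexHull ℝ

theorem isCompact_simplexBoundary (s : Finset E) : IsCompact (simplexBoundary s) := by
  have : {t : Finset E | t ⊂ s}.Finite := s.finite_toSet.finite_subsets.preimage
    Finset.coe_injective.injOn |>.subset fun t ht => Finset.coe_subset.2 ht.1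
  exact this.isCompact_biUnion fun t _ => isCompact_simplex t

theorem simplexBoundary_subset (s : Finset E) : simplexBoundary s ⊆ simplex s :=
  iUnion₂_subset fun _ ht => convexHull_mono (Finset.coe_subset.2 ht.1)

theorem simplexBoundary_nonempty (hs : 2 ≤ s.card) : (simplexBoundary s).Nonempty := by
  obtain ⟨v, hv⟩ : s.Nonempty := Finset.card_pos.1 (by omega)
  refine ⟨v, mem_iUnion₂.2 ⟨{v}, Finset.ssubset_iff_subset_ne.2 ⟨by simpa using hv, ?_⟩, ?_⟩⟩
  · rintro rfl
    simp at hs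
  · simp [simplex]

theorem barycentre_eq_sum (s : Finset E) : barycentre s = ∑ v ∈ s, (s.card : ℝ)⁻¹ • v := by
  rw [barycentre, Finset.smul_sum]

theorem sum_inv_card {α : Type*} {s : Finset α} (hs : s.Nonempty) : ∑ _v ∈ s, (s.card : ℝ)⁻¹ = 1 := by
  have : (s.card : ℝ) ≠ 0 := by exact_mod_cast hs.card_pos.ne'
  rw [Finset.sum_const, nsmul_eq_mul, mul_inv_cancel₀ this]

theorem barycentre_mem_simplex (hs : s.Nonempty) : barycentre s ∈ simplex s := by
  rw [simplex, Finset.mem_convexHull']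
  exact ⟨fun _ => (s.card : ℝ)⁻¹, fun _ _ => by positivity, sum_inv_card hs,
    (barycentre_eq_sum s).symm⟩

theorem simplex_subset_affineSpan (s : Finset E) : simplex s ⊆ affineSpan ℝ (s : Set E) :=
  convexHull_subset_affineSpan _

/-- A point of a simplex moved towards the barycentre is not in the boundary. -/
theorem barycentre_add_smul_notMem_simplexBoundary (hs : AffineIndependent ℝ ((↑) : s → E))
    {q : E} (hq : q ∈ simplex s) {r : ℝ} (hr0 : 0 ≤ r) (hr1 : r < 1) :
    barycentre s + r • (q - barycentre s) ∉ simplexBoundary s := by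
  rw [simplex, Finset.mem_convexHull'] at hq
  obtain ⟨w, hw0, hw1, rfl⟩ := hq
  have hne : s.Nonempty := by
    rw [Finset.nonempty_iff_ne_empty]
    rintro rfl
    simp at hw1
  have hpos : 0 < (s.card : ℝ)⁻¹ := inv_pos.2 (by exact_mod_cast hne.card_pos)
  have e : barycentre s + r • (∑ v ∈ s, w v • v - barycentre s)
      = ∑ v ∈ s, ((1 - r) * (s.card : ℝ)⁻¹ + r * w v) • v := by
    rw [barycentre_eq_sum, ← Finset.sum_sub_distrib, Finset.smul_sum, ← Finset.sum_add_distrib]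
    exact Finset.sum_congr rfl fun v _ => by module
  rw [e, sum_mem_simplexBoundary_iff hs (by
    rw [Finset.sum_add_distrib, ← Finset.mul_sum, ← Finset.mul_sum, sum_inv_card hne, hw1]
    ring)]
  rintro ⟨-, v, hv, h⟩
  have h1 : 0 < (1 - r) * (s.card : ℝ)⁻¹ := mul_pos (by linarith) hpos
  have h2 := mul_nonneg hr0 (hw0 v hv)
  linarith

theorem barycentre_notMem_simplexBoundary (hs : AffineIndependent ℝ ((↑) : s → E))
    (hne : s.Nonempty) : barycentre s ∉ simplexBoundary s := by
  simpa using barycentre_add_smul_notMem_simplexBoundary hs (barycentre_mem_simplex hne) le_rfl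
    one_pos

theorem inradius_pos (hs : AffineIndependent ℝ ((↑) : s → E)) (h2 : 2 ≤ s.card) :
    0 < inradius s :=
  ((isCompact_simplexBoundary s).isClosed.notMem_iff_infDist_pos (simplexBoundary_nonempty h2)).1
    (barycentre_notMem_simplexBoundary hs (Finset.card_pos.1 (by omega)))

theorem inradius_le_diam (h2 : 2 ≤ s.card) : inradius s ≤ Metric.diam (simplex s) := by
  obtain ⟨y, hy⟩ := simplexBoundary_nonempty h2
  exact (Metric.infDist_le_dist_of_mem hy).trans (Metric.dist_le_diam_of_mem
    (isCompact_simplex s).isBounded (barycentre_mem_simplex (Finset.card_pos.1 (by omega)))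
    (simplexBoundary_subset s hy))

/-- The simplex contains the ball of its affine span around the barycentre whose radius is the
inradius. -/
theorem mem_simplex_of_dist_barycentre_le (hs : AffineIndependent ℝ ((↑) : s → E))
    (hne : s.Nonempty) {y : E} (hy : y ∈ affineSpan ℝ (s : Set E))
    (hd : dist y (barycentre s) ≤ inradius s) : y ∈ simplex s := by
  have hb := barycentre_mem_simplex hne
  by_cases hyb : y = barycentre s
  · rwa [hyb]
  have hmem : radialRetraction s y ∈ rayThrough (barycentre s) y ∩ simplexBoundary s := by
    rw [rayThrough_inter_simplexBoundary hs hy hyb]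
    rfl
  obtain ⟨⟨t, ht, e⟩, hbd⟩ := hmem
  have hdist : dist (barycentre s) (radialRetraction s y) = t * dist y (barycentre s) := by
    rw [e, dist_eq_norm, dist_eq_norm, sub_add_cancel_left, norm_neg, norm_smul,
      Real.norm_of_nonneg ht]
  -- The ray meets the boundary no nearer than the inradius, so not before reaching `y`; thus `y`
  -- lies on a segment inside the simplex.
  have hle : inradius s ≤ t * dist y (barycentre s) :=
    hdist ▸ Metric.infDist_le_dist_of_mem hbd
  have hpos : 0 < dist y (barycentre s) := dist_pos.2 hyb
  have ht1 : 1 ≤ t := by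
    by_contra! h
    nlinarith
  have hconv : Convex ℝ (simplex s) := convex_convexHull ℝ _
  have e2 : y = (1 - t⁻¹) • barycentre s + t⁻¹ • radialRetraction s y := by
    have : t⁻¹ * t = 1 := inv_mul_cancel₀ (by linarith)
    rw [e, smul_add, smul_smul, this]
    module
  rw [e2]
  exact hconv hb (simplexBoundary_subset s hbd) (sub_nonneg.2 (inv_le_one_of_one_le₀ ht1))
    (by positivity) (by ring)

theorem shrink_apply (s : Finset E) (ε : ℝ) (x : E) :
    shrink s ε x = barycentre s + (ε / inradius s) • (x - barycentre s) := by
  simp [shrink, AffineMap.homothety_apply, add_comm]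

theorem shrink_mem_simplex (hne : s.Nonempty) (hε : 0 ≤ ε) (hlt : ε ≤ inradius s) {q : E}
    (hq : q ∈ simplex s) : shrink s ε q ∈ simplex s := by
  rw [shrink_apply]
  exact (convex_convexHull ℝ _).add_smul_sub_mem (barycentre_mem_simplex hne) hq
    ⟨div_nonneg hε (hε.trans hlt), div_le_one_of_le₀ hlt (hε.trans hlt)⟩

theorem shrink_notMem_simplexBoundary (hs : AffineIndependent ℝ ((↑) : s → E)) (hε : 0 < ε)
    (hlt : ε < inradius s) {q : E} (hq : q ∈ simplex s) : shrink s ε q ∉ simplexBoundary s := by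
  rw [shrink_apply]
  exact barycentre_add_smul_notMem_simplexBoundary hs hq (by have := hε.trans hlt; positivity)
    ((div_lt_one (hε.trans hlt)).2 hlt)

/-- A smaller shrunken copy of a simplex is contained in a larger one. -/
theorem shrink_image_subset (hne : s.Nonempty) {ε' : ℝ} (hε : 0 ≤ ε) (hle : ε ≤ ε')
    (hε' : 0 < ε') (hs : 0 < inradius s) :
    shrink s ε '' simplex s ⊆ shrink s ε' '' simplex s := by
  rintro _ ⟨q, hq, rfl⟩
  refine ⟨barycentre s + (ε / ε') • (q - barycentre s),
    (convex_convexHull ℝ _).add_smul_sub_mem (barycentre_mem_simplex hne) hq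
      ⟨by positivity, div_le_one_of_le₀ hle hε'.le⟩, ?_⟩
  rw [shrink_apply, shrink_apply, add_sub_cancel_left, smul_smul]
  congr 2
  field_simp

/-- With `r = ε / inradius s`, the shrunken `q` is `(1 - r) • b + r • q`. A displacement of length
at most `inradius s - ε = (1 - r) * inradius s` can be absorbed by moving `b` within the inscribed
ball. -/
theorem mem_simplex_of_dist_shrink_le (hs : AffineIndependent ℝ ((↑) : s → E)) (hne : s.Nonempty)
    (hε : 0 < ε) (hlt : ε < inradius s) {q y : E} (hq : q ∈ simplex s)
    (hy : y ∈ affineSpan ℝ (s : Set E)) (hd : dist y (shrink s ε q) ≤ inradius s - ε) :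
    y ∈ simplex s := by
  have hpos : 0 < inradius s := hε.trans hlt
  set r := ε / inradius s with hr
  have hr1 : r < 1 := (div_lt_one hpos).2 hlt
  have hr0 : 0 ≤ r := by positivity
  have hb := barycentre_mem_simplex hne
  set z : E := barycentre s + (1 - r)⁻¹ • (y - shrink s ε q) with hz
  have hzs : z ∈ simplex s := by
    refine mem_simplex_of_dist_barycentre_le hs hne ?_ ?_
    · rw [hz, add_comm, ← vadd_eq_add]
      refine AffineSubspace.vadd_mem_of_mem_direction (Submodule.smul_mem _ _ ?_)
        (simplex_subset_affineSpan s hb)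
      exact AffineSubspace.vsub_mem_direction hy
        (simplex_subset_affineSpan s (shrink_mem_simplex hne hε.le hlt.le hq))
    · rw [hz, dist_eq_norm, add_sub_cancel_left, norm_smul, norm_inv,
        Real.norm_of_nonneg (by linarith), ← dist_eq_norm, inv_mul_le_iff₀ (by linarith)]
      have : (1 - r) * inradius s = inradius s - ε := by
        rw [hr]
        field_simp
      rwa [this]
  have e : y = (1 - r) • z + r • q := by
    have : (1 - r) * (1 - r)⁻¹ = 1 := mul_inv_cancel₀ (by linarith)
    rw [hz, smul_add, smul_smul, this, shrink_apply, ← hr]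
    module
  rw [e]
  exact (convex_convexHull ℝ _) hzs hq (by linarith) hr0 (by ring)

theorem radialRetraction_of_mem_simplexBoundary (hs : AffineIndependent ℝ ((↑) : s → E))
    (hne : s.Nonempty) {x : E} (hx : x ∈ simplexBoundary s) : radialRetraction s x = x := by
  have hxb : x ≠ barycentre s := fun e => barycentre_notMem_simplexBoundary hs hne (e ▸ hx)
  have h : x ∈ rayThrough (barycentre s) x ∩ simplexBoundary s :=
    ⟨⟨1, zero_le_one, by simp⟩, hx⟩
  rw [rayThrough_inter_simplexBoundary hs
    (simplex_subset_affineSpan s (simplexBoundary_subset s hx)) hxb] at h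
  exact h.symm

theorem squeezeSimplex_of_notMem {x : E} (hx : x ∉ simplex s) : squeezeSimplex s ε x = x := by
  rw [squeezeSimplex, if_neg hx]

theorem squeezeSimplex_of_mem_simplexBoundary (hs : AffineIndependent ℝ ((↑) : s → E))
    (hne : s.Nonempty) (hε : 0 < ε) (hlt : ε < inradius s) {x : E} (hx : x ∈ simplexBoundary s) :
    squeezeSimplex s ε x = x := by
  rw [squeezeSimplex, if_pos (simplexBoundary_subset s hx), if_neg,
    radialRetraction_of_mem_simplexBoundary hs hne hx]
  rintro ⟨q, hq, rfl⟩
  exact shrink_notMem_simplexBoundary hs hε hlt hq hx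

theorem squeezeSimplex_shrink (hne : s.Nonempty) (hε : 0 < ε) (hlt : ε < inradius s) {q : E}
    (hq : q ∈ simplex s) : squeezeSimplex s ε (shrink s ε q) = q := by
  rw [squeezeSimplex, if_pos (shrink_mem_simplex hne hε.le hlt.le hq),
    if_pos (mem_image_of_mem _ hq), expand_shrink hε (hε.trans hlt)]

theorem squeezeSimplex_mem_simplex (hs : AffineIndependent ℝ ((↑) : s → E)) (hne : s.Nonempty)
    (hε : 0 < ε) (hlt : ε < inradius s) {x : E} (hx : x ∈ simplex s) :
    squeezeSimplex s ε x ∈ simplex s := by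
  rw [squeezeSimplex, if_pos hx]
  split_ifs with h
  · obtain ⟨q, hq, rfl⟩ := h
    rwa [expand_shrink hε (hε.trans hlt)]
  · have hxb : x ≠ barycentre s := fun e =>
      h ⟨barycentre s, barycentre_mem_simplex hne, by rw [shrink_apply, e]; simp⟩
    have : radialRetraction s x ∈ rayThrough (barycentre s) x ∩ simplexBoundary s := by
      rw [rayThrough_inter_simplexBoundary hs (simplex_subset_affineSpan s hx) hxb]
      rfl
    exact simplexBoundary_subset s this.2

end SimplexGeometry

/-! ### Affine extension from the vertices -/

section AffineExtension

variable {E W : Type*} [NormedAddCommGroup E] [NormedSpace ℝ E] [FiniteDimensional ℝ E]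
  [AddCommGroup W] [Module ℝ W] {s : Finset E}

/-- A map on an affinely independent set extends to an affine map. -/
theorem exists_affineMap_eqOn (hs : AffineIndependent ℝ ((↑) : s → E)) (w : E → W) :
    ∃ B : E →ᵃ[ℝ] W, ∀ v ∈ s, B v = w v := by
  obtain ⟨t, hst, ht, hspan⟩ := exists_subset_affineIndependent_affineSpan_eq_top (k := ℝ)
    (s := (s : Set E)) hs
  have : Finite t := finite_set_of_fin_dim_affineIndependent ℝ ht
  have := Fintype.ofFinite t
  let b : AffineBasis t ℝ E := ⟨(↑), ht, by rw [Subtype.range_coe]; exact hspan⟩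
  refine ⟨∑ i : t, (LinearMap.toSpanSingleton ℝ W (w i)).toAffineMap.comp (b.coord i),
    fun v hv => ?_⟩
  classical
  have hb : ∀ i, b.coord i v = if i = ⟨v, hst hv⟩ then 1 else 0 := fun i =>
    b.coord_apply i ⟨v, hst hv⟩
  have hsum : ∀ (u : Finset t) (f : t → E →ᵃ[ℝ] W) (x : E),
      (∑ i ∈ u, f i) x = ∑ i ∈ u, f i x := by
    intro u f x
    induction u using Finset.induction_on with
    | empty => simp
    | insert i u hi ih => rw [Finset.sum_insert hi, Finset.sum_insert hi, ← ih]; rfl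
  rw [hsum, Finset.sum_eq_single ⟨v, hst hv⟩]
  · simp [hb]
  · intro i _ hi
    simp [hb, hi]
  · simp

end AffineExtension

/-! ### Transfer of Brouwer's theorem to an arbitrary simplex -/

section SimplexFixedPoint

variable {E : Type*} [NormedAddCommGroup E] [NormedSpace ℝ E] [FiniteDimensional ℝ E]
  {s : Finset E}

/-- **Brouwer's fixed point theorem** for a simplex of dimension at least one. -/
theorem exists_fixedPoint_simplex (hs : AffineIndependent ℝ ((↑) : s → E)) (h2 : 2 ≤ s.card)
    {Φ : E → E} (hΦ : MapsTo Φ (simplex s) (simplex s)) (hc : ContinuousOn Φ (simplex s)) :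
    ∃ y ∈ simplex s, Φ y = y := by
  classical
  have : Nontrivial s := Fintype.one_lt_card_iff_nontrivial.1 (by
    rw [Fintype.card_coe]
    omega)
  -- `D` extends the barycentric coordinates to the whole space, which makes their continuity
  -- automatic; `S` inverts them.
  obtain ⟨D, hD⟩ := exists_affineMap_eqOn hs
    (fun v : E => fun i : s => if v = i then (1 : ℝ) else 0)
  let S : (s → ℝ) → E := fun c => ∑ i, c i • (i : E)
  have hSD : ∀ c ∈ stdSimplex ℝ s, D (S c) = c := by
    intro c hc
    have h1 : S c = Finset.univ.affineCombination ℝ ((↑) : s → E) c := by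
      rw [Finset.affineCombination_eq_linear_combination _ _ _ hc.2]
    rw [h1, Finset.map_affineCombination _ _ _ hc.2,
      Finset.affineCombination_eq_linear_combination _ _ _ hc.2]
    ext j
    simp only [Function.comp_apply, Finset.sum_apply, Pi.smul_apply, smul_eq_mul]
    rw [Finset.sum_eq_single j]
    · rw [hD j j.2]
      simp
    · intro i _ hij
      have : (i : E) ≠ j := fun e => hij (Subtype.ext e)
      simp [hD i i.2, this]
    · simp
  have hS : ∀ y ∈ simplex s, ∃ c ∈ stdSimplex ℝ s, S c = y := by
    intro y hy
    rw [simplex, Finset.mem_convexHull'] at hy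
    obtain ⟨w, h0, h1, rfl⟩ := hy
    exact ⟨fun i => w i, ⟨fun i => h0 i i.2, (Finset.sum_coe_sort s w).trans h1⟩,
      Finset.sum_coe_sort s fun v => w v • v⟩
  have hSmem : MapsTo S (stdSimplex ℝ s) (simplex s) := by
    intro c hc
    exact (convex_convexHull ℝ _).sum_mem (fun i _ => hc.1 i) hc.2
      fun i _ => subset_convexHull ℝ _ i.2
  have hDmem : MapsTo D (simplex s) (stdSimplex ℝ s) := by
    intro y hy
    obtain ⟨c, hc, rfl⟩ := hS y hy
    rwa [hSD c hc]
  have hDS : ∀ y ∈ simplex s, S (D y) = y := by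
    intro y hy
    obtain ⟨c, hc, rfl⟩ := hS y hy
    rw [hSD c hc]
  have hScont : Continuous S := by fun_prop
  have hDcont : Continuous D := D.continuous_of_finiteDimensional
  obtain ⟨c, hcmem, hfix⟩ := exists_fixedPoint_stdSimplex (f := fun c => D (Φ (S c)))
    (hDmem.comp (hΦ.comp hSmem))
    (hDcont.comp_continuousOn (hc.comp hScont.continuousOn hSmem))
  refine ⟨S c, hSmem hcmem, ?_⟩
  have := congrArg S hfix
  rwa [hDS _ (hΦ (hSmem hcmem))] at this

end SimplexFixedPoint

/-! ### Perturbations of the identity of a simplex -/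

section Perturbation

variable {F : Type*} [NormedAddCommGroup F] [InnerProductSpace ℝ F] [FiniteDimensional ℝ F]

/-- A map that is close to the identity on a simplex attains every value in the shrunken simplex
near which it takes values only in the simplex. -/
theorem exists_eq_shrink_of_close {s : Finset F} (hs : AffineIndependent ℝ ((↑) : s → F))
    (h2 : 2 ≤ s.card) {ε : ℝ} (hε : 0 < ε) (hε2 : 2 * ε ≤ inradius s) {G : F → F}
    (hG : ContinuousOn G (simplex s)) (hclose : ∀ y ∈ simplex s, ‖y - G y‖ < ε) {q : F}
    (hq : q ∈ simplex s)
    (hloc : ∀ y ∈ simplex s, dist (G y) (shrink s ε q) < 2 * ε → G y ∈ simplex s) :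
    ∃ y ∈ simplex s, G y = shrink s ε q := by
  have hne : s.Nonempty := Finset.card_pos.1 (by omega)
  set V := (affineSpan ℝ (s : Set F)).direction
  set p := shrink s ε q
  have hp : p ∈ affineSpan ℝ (s : Set F) :=
    simplex_subset_affineSpan s (shrink_mem_simplex hne hε.le (by linarith) hq)
  have hnorm : ∀ y ∈ simplex s, ‖V.starProjection (y - G y)‖ < ε := fun y hy =>
    (V.norm_starProjection_apply_le _).trans_lt (hclose y hy)
  -- Projecting keeps the map in the affine span, which `G` itself may leave.
  obtain ⟨y, hy, hfix⟩ := exists_fixedPoint_simplex hs h2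
    (Φ := fun y => V.starProjection (y - G y) + p) (by
      intro y hy
      refine mem_simplex_of_dist_shrink_le hs hne hε (by linarith) hq
        (AffineSubspace.vadd_mem_of_mem_direction (V.starProjection_apply_mem _) hp) ?_
      rw [dist_eq_norm, add_sub_cancel_right]
      linarith [hnorm y hy])
    ((V.starProjection.continuous.comp_continuousOn (continuousOn_id.sub hG)).add
      continuousOn_const)
  refine ⟨y, hy, ?_⟩
  have hyp : dist y p < ε := by
    have := hnorm y hy
    rwa [← add_sub_cancel_right (V.starProjection (y - G y)) p, hfix, ← dist_eq_norm] at this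
  have hmem : G y ∈ simplex s := by
    refine hloc y hy ?_
    have h1 := dist_triangle (G y) y p
    have h3 := hclose y hy
    rw [← dist_eq_norm, dist_comm] at h3
    linarith
  have hV : y - G y ∈ V := AffineSubspace.vsub_mem_direction (simplex_subset_affineSpan s hy)
    (simplex_subset_affineSpan s hmem)
  have hfix' : V.starProjection (y - G y) + p = y := hfix
  rw [Submodule.starProjection_eq_self_iff.2 hV] at hfix'
  have : p = y - (y - G y) := eq_sub_of_add_eq' hfix'
  rw [this, sub_sub_cancel]

end Perturbation

/-! ### Maximal simplices, the squeezing map and sections of simplicial maps -/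

section ComplexGeometry

variable {E F : Type*} [NormedAddCommGroup E] [NormedSpace ℝ E]
  [NormedAddCommGroup F] [NormedSpace ℝ F] {K : SimplicialComplex ℝ E}
  {L : SimplicialComplex ℝ F} {s t : Finset F} {ε : ℝ} {x : F}

/-- The common face is proper, since a maximal `s` is contained in no other simplex. -/
theorem mem_simplexBoundary_of_mem_facets (hs : s ∈ L.facets) (ht : t ∈ L.faces) (hne : t ≠ s)
    (hxs : x ∈ simplex s) (hxt : x ∈ simplex t) : x ∈ simplexBoundary s := by
  classical
  refine mem_iUnion₂.2 ⟨s ∩ t, Finset.ssubset_iff_subset_ne.2 ⟨Finset.inter_subset_left,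
    fun e => hne (hs.2 ht (Finset.inter_eq_left.1 e)).symm⟩, ?_⟩
  rw [simplex, Finset.coe_inter]
  exact L.inter_subset_convexHull hs.1 ht ⟨hxs, hxt⟩

theorem exists_mem_facets_superset (hL : L.faces.Finite) (hs : s ∈ L.faces) :
    ∃ t ∈ L.facets, s ⊆ t := by
  obtain ⟨t, hst, ht⟩ := hL.exists_le_maximal hs
  exact ⟨t, ⟨ht.prop, fun u hu htu => ht.eq_of_le hu htu⟩, hst⟩

theorem exists_mem_facets_of_mem_space (hL : L.faces.Finite) (hx : x ∈ L.space) :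
    ∃ t ∈ L.facets, x ∈ simplex t := by
  obtain ⟨s, hs, hxs⟩ := SimplicialComplex.mem_space_iff.1 hx
  obtain ⟨t, ht, hst⟩ := exists_mem_facets_superset hL hs
  exact ⟨t, ht, convexHull_mono (Finset.coe_subset.2 hst) hxs⟩

theorem isCompact_space (hL : L.faces.Finite) : IsCompact L.space :=
  hL.isCompact_biUnion fun t _ => isCompact_simplex t

theorem squeezeSimplex_eq_self (hs : s ∈ L.facets) (ht : t ∈ L.faces) (hne : t ≠ s) (hε : 0 < ε)
    (hlt : ε < inradius s) (hx : x ∈ simplex t) : squeezeSimplex s ε x = x := by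
  by_cases hxs : x ∈ simplex s
  · exact squeezeSimplex_of_mem_simplexBoundary (L.indep hs.1) (L.nonempty_of_mem_faces hs.1) hε
      hlt (mem_simplexBoundary_of_mem_facets hs ht hne hxs hx)
  · exact squeezeSimplex_of_notMem hxs

-- All other factors fix the simplex `t` pointwise and the factor of `t` preserves it, so only the
-- latter acts, in whatever order.
open Classical in
theorem foldr_squeezeSimplex (hε : 0 < ε) (ht : t ∈ L.facets) (hx : x ∈ simplex t)
    {l : List (Finset F)} (hnd : l.Nodup) (hl : ∀ s ∈ l, s ∈ L.facets ∧ ε < inradius s) :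
    ((l.map fun s => squeezeSimplex s ε).foldr (fun p q => p ∘ q) id) x
      = if t ∈ l then squeezeSimplex t ε x else x := by
  induction l with
  | nil => simp
  | cons s l ih =>
    rw [List.nodup_cons] at hnd
    have hs := hl s List.mem_cons_self
    rw [List.map_cons, List.foldr_cons, Function.comp_apply,
      ih hnd.2 fun u hu => hl u (List.mem_cons_of_mem _ hu)]
    by_cases hts : t = s
    · subst hts
      simp [hnd.1]
    · have hmem : t ∈ s :: l ↔ t ∈ l := by simp [hts]
      simp only [hmem]
      split_ifs with htl
      · exact squeezeSimplex_eq_self hs.1 ht.1 hts hε hs.2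
          (squeezeSimplex_mem_simplex (L.indep ht.1) (L.nonempty_of_mem_faces ht.1) hε
            (hl t (List.mem_cons_of_mem _ htl)).2 hx)
      · exact squeezeSimplex_eq_self hs.1 ht.1 hts hε hs.2 hx

open Classical in
theorem squeezingMap_eq (hL : L.faces.Finite) (hε : 0 < ε)
    (hlt : ∀ τ ∈ maximalSimplices L, ε < inradius τ) (ht : t ∈ L.facets) (hx : x ∈ simplex t) :
    squeezingMap L hL ε x = if t ∈ maximalSimplices L then squeezeSimplex t ε x else x := by
  rw [squeezingMap, foldr_squeezeSimplex hε ht hx (Finset.nodup_toList _)]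
  · simp
  · intro s hs
    have hs' : s ∈ maximalSimplices L := by simpa using hs
    exact ⟨hs'.1, hlt s hs'⟩

theorem squeezingMap_mem_simplex (hL : L.faces.Finite) (hε : 0 < ε)
    (hlt : ∀ τ ∈ maximalSimplices L, ε < inradius τ) (ht : t ∈ L.facets) (hx : x ∈ simplex t) :
    squeezingMap L hL ε x ∈ simplex t := by
  classical
  rw [squeezingMap_eq hL hε hlt ht hx]
  split_ifs with h
  · exact squeezeSimplex_mem_simplex (L.indep ht.1) (L.nonempty_of_mem_faces ht.1) hε (hlt t h) hx
  · exact hx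

/-- A compact set that meets no simplex other than `t` has a neighbourhood in which the complex
consists of `t` only. -/
theorem exists_forall_dist_lt_mem_simplex (hL : L.faces.Finite) {C : Set F} (hC : IsCompact C)
    (hdisj : ∀ s ∈ L.faces, s ≠ t → Disjoint C (simplex s)) :
    ∃ η > 0, ∀ p ∈ C, ∀ y ∈ L.space, dist y p < η → y ∈ simplex t := by
  have hU : IsCompact (⋃ s ∈ {s ∈ L.faces | s ≠ t}, simplex s) :=
    (hL.subset (sep_subset _ _)).isCompact_biUnion fun s _ => isCompact_simplex s
  have hCU : Disjoint C (⋃ s ∈ {s ∈ L.faces | s ≠ t}, simplex s) :=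
    disjoint_iUnion₂_right.2 fun s hs => hdisj s hs.1 hs.2
  obtain ⟨η, hη, h⟩ := hCU.exists_thickenings hC hU.isClosed
  refine ⟨η, hη, fun p hp y hy hyp => ?_⟩
  obtain ⟨s, hs, hys⟩ := SimplicialComplex.mem_space_iff.1 hy
  by_cases hst : s = t
  · exact hst ▸ hys
  · exact absurd (Metric.self_subset_thickening hη _ (mem_iUnion₂.2 ⟨s, ⟨hs, hst⟩, hys⟩))
      (disjoint_left.1 h (Metric.mem_thickening_iff.2 ⟨p, hp, hyp⟩))

open Filter Topology in
/-- For small `ε`, the complex consists near the shrunken copy of a maximal simplex of that simplex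
only. -/
theorem eventually_mem_simplex_of_dist_shrink_lt (hL : L.faces.Finite)
    (ht : t ∈ maximalSimplices L) :
    ∀ᶠ ε in 𝓝[>] (0 : ℝ), 2 * ε ≤ inradius t ∧ ∀ q ∈ simplex t, ∀ y ∈ L.space,
      dist y (shrink t ε q) < 2 * ε → y ∈ simplex t := by
  have hind := L.indep ht.1.1
  have hne := L.nonempty_of_mem_faces ht.1.1
  have hpos := inradius_pos hind ht.2
  -- The copy for half the inradius is compact, misses all other simplices and contains every
  -- smaller copy, so one `η` serves all small `ε`.
  have hhalf : 0 < inradius t / 2 := by positivity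
  have hcont : Continuous (shrink t (inradius t / 2)) := by
    simp only [funext (shrink_apply t _)]
    fun_prop
  obtain ⟨η, hη, h⟩ := exists_forall_dist_lt_mem_simplex (t := t) hL
    ((isCompact_simplex t).image hcont) (by
      intro s hs hst
      rw [disjoint_left]
      rintro _ ⟨q, hq, rfl⟩ hmem
      exact shrink_notMem_simplexBoundary hind hhalf (by linarith) hq
        (mem_simplexBoundary_of_mem_facets ht.1 hs hst
          (shrink_mem_simplex hne hhalf.le (by linarith) hq) hmem))
  filter_upwards [Ioo_mem_nhdsGT (lt_min hhalf (half_pos hη))] with ε hε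
  have h1 : ε < inradius t / 2 := hε.2.trans_le (min_le_left _ _)
  have h2 : ε < η / 2 := hε.2.trans_le (min_le_right _ _)
  refine ⟨by linarith, fun q hq y hy hd => h (shrink t ε q) ?_ y hy (by linarith)⟩
  exact shrink_image_subset hne hε.1.le h1.le hhalf hpos (mem_image_of_mem _ hq)

open Filter Topology in
/-- For small `ε`, the complex consists near a maximal simplex of dimension zero of that vertex
only. -/
theorem eventually_mem_simplex_of_dist_lt (hL : L.faces.Finite)
    (ht : t ∈ L.facets) (hcard : t.card = 1) :
    ∀ᶠ ε in 𝓝[>] (0 : ℝ), ∀ p ∈ simplex t, ∀ y ∈ L.space, dist y p < ε → y ∈ simplex t := by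
  obtain ⟨η, hη, h⟩ := exists_forall_dist_lt_mem_simplex (t := t) hL (isCompact_simplex t) (by
    intro s hs hst
    obtain ⟨v, rfl⟩ := Finset.card_eq_one.1 hcard
    rw [disjoint_left]
    intro x hx hxs
    have := mem_simplexBoundary_of_mem_facets ht hs hst hx hxs
    -- A single vertex is its own barycentre, hence not a boundary point.
    have hx' : x = barycentre {v} := by simpa [simplex, barycentre] using hx
    exact barycentre_notMem_simplexBoundary (L.indep ht.1) (L.nonempty_of_mem_faces ht.1)
      (hx' ▸ this))
  filter_upwards [Ioo_mem_nhdsGT hη] with ε hε p hp y hy hd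
  exact h p hp y hy (hd.trans hε.2)

/-- A surjective simplicial map has an affine section over each maximal simplex. -/
theorem exists_affine_section [FiniteDimensional ℝ F] {h : K.space → L.space}
    (hsimp : IsSimplicialMap K L h) (hsurj : Function.Surjective h) (ht : t ∈ L.facets) :
    ∃ B : F →ᵃ[ℝ] E, ∀ y ∈ simplex t, ∃ hB : B y ∈ K.space, (h ⟨B y, hB⟩ : F) = y := by
  have hind := L.indep ht.1
  have hne := L.nonempty_of_mem_faces ht.1
  have hb := barycentre_mem_simplex hne
  obtain ⟨x, hx⟩ := hsurj ⟨barycentre t, SimplicialComplex.convexHull_subset_space ht.1 hb⟩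
  obtain ⟨s, hs, hxs⟩ := SimplicialComplex.mem_space_iff.1 x.2
  obtain ⟨A, hA⟩ := hsimp.affine_on_simplex s hs
  obtain ⟨u, hu, hus⟩ := hsimp.map_vertices s hs
  have hAu : A '' s = u := by
    rw [hus]
    ext y
    constructor
    · rintro ⟨v, hv, rfl⟩
      exact ⟨⟨v, SimplicialComplex.subset_space hs hv⟩, hv,
        hA _ (subset_convexHull ℝ _ hv)⟩
    · rintro ⟨v, hv, rfl⟩
      exact ⟨v, hv, (hA v (subset_convexHull ℝ _ hv)).symm⟩
  -- The barycentre of `t` is interior to `t`, so the image simplex `u` containing it must be `t`.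
  have hbu : barycentre t ∈ simplex u := by
    rw [simplex, ← hAu, ← AffineMap.image_convexHull]
    exact ⟨x, hxs, by rw [← hA x hxs, hx]⟩
  have hut : u = t := by
    by_contra hut
    exact barycentre_notMem_simplexBoundary hind hne
      (mem_simplexBoundary_of_mem_facets ht hu hut hb hbu)
  subst hut
  have hw : ∀ v : F, ∃ w : E, v ∈ u → w ∈ s ∧ A w = v := by
    intro v
    by_cases hv : v ∈ u
    · have : v ∈ A '' s := hAu ▸ hv
      obtain ⟨w, hw, e⟩ := this
      exact ⟨w, fun _ => ⟨hw, e⟩⟩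
    · exact ⟨0, fun h => absurd h hv⟩
  choose w hw using hw
  obtain ⟨B, hB⟩ := exists_affineMap_eqOn hind w
  have hBs : simplex u ⊆ B ⁻¹' convexHull ℝ (s : Set E) := by
    refine convexHull_min (fun v hv => ?_) ((convex_convexHull ℝ _).affine_preimage B)
    rw [mem_preimage, hB v hv]
    exact subset_convexHull ℝ _ (hw v hv).1
  have hAB : EqOn (A.comp B) (AffineMap.id ℝ F) (simplex u) := by
    refine EqOn.mono (simplex_subset_affineSpan u) (AffineMap.eqOn_affineSpan fun v hv => ?_)
    rw [AffineMap.comp_apply, hB v hv, (hw v hv).2, AffineMap.id_apply]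
  refine ⟨B, fun y hy => ⟨SimplicialComplex.convexHull_subset_space hs (hBs hy), ?_⟩⟩
  exact (hA ⟨B y, _⟩ (hBs hy)).trans (hAB hy)

end ComplexGeometry

/-! ### The uniform norm -/

section UniformNorm

variable {X F : Type*} [NormedAddCommGroup F]

/-- Boundedness is essential: an unbounded real supremum takes the default value zero. -/
theorem norm_le_uniformNorm_sub {C : Set F} (hC : Bornology.IsBounded C) {f g : X → F}
    (hf : ∀ x, f x ∈ C) (hg : ∀ x, g x ∈ C) (x : X) :
    ‖f x - g x‖ ≤ uniformNorm fun x => f x - g x := by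
  refine le_ciSup (f := fun x => ‖f x - g x‖) ⟨Metric.diam C, ?_⟩ x
  rintro _ ⟨y, rfl⟩
  exact (dist_eq_norm (f y) (g y)).ge.trans (Metric.dist_le_diam_of_mem hC (hf y) (hg y))

theorem uniformNorm_nonneg (f : X → F) : 0 ≤ uniformNorm f :=
  Real.iSup_nonneg fun _ => norm_nonneg _

end UniformNorm

/-! ### Surjectivity and the norm estimate -/

section Main

variable {E F : Type*} [NormedAddCommGroup E] [NormedSpace ℝ E]
  [NormedAddCommGroup F] [InnerProductSpace ℝ F]
  {K : SimplicialComplex ℝ E} {L : SimplicialComplex ℝ F} {h g : K.space → L.space}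

/-- A map close to a surjective simplicial map becomes surjective after squeezing. -/
theorem range_squeezingMap_comp [FiniteDimensional ℝ F] (hL : L.faces.Finite) (hsimp : IsSimplicialMap K L h)
    (hsurj : Function.Surjective h) {ε : ℝ} (hε : 0 < ε)
    (hlt : ∀ τ ∈ maximalSimplices L, ε < inradius τ)
    (hmax : ∀ τ ∈ maximalSimplices L, 2 * ε ≤ inradius τ ∧ ∀ q ∈ simplex τ, ∀ y ∈ L.space,
      dist y (shrink τ ε q) < 2 * ε → y ∈ simplex τ)
    (hzero : ∀ τ ∈ L.facets, τ.card = 1 → ∀ p ∈ simplex τ, ∀ y ∈ L.space,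
      dist y p < ε → y ∈ simplex τ)
    (hg : Continuous g) (hclose : ∀ x, ‖(h x : F) - g x‖ < ε) :
    range (fun x => squeezingMap L hL ε (g x)) = L.space := by
  classical
  refine Subset.antisymm ?_ fun z hz => ?_
  · rintro _ ⟨x, rfl⟩
    obtain ⟨τ, hτ, hx⟩ := exists_mem_facets_of_mem_space hL (g x).2
    exact SimplicialComplex.convexHull_subset_space hτ.1
      (squeezingMap_mem_simplex hL hε hlt hτ hx)
  obtain ⟨τ, hτ, hzτ⟩ := exists_mem_facets_of_mem_space hL hz
  have hne := L.nonempty_of_mem_faces hτ.1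
  have hcardpos := hne.card_pos
  by_cases hτm : τ ∈ maximalSimplices L
  · obtain ⟨B, hB⟩ := exists_affine_section hsimp hsurj hτ
    choose hBK hhB using hB
    -- The value zero is a dummy: `B` maps `τ` into `|K|`, and only `τ` matters.
    set G : F → F := fun y => if hy : B y ∈ K.space then g ⟨B y, hy⟩ else 0
    have hGeq : ∀ y (hy : y ∈ simplex τ), G y = g ⟨B y, hBK y hy⟩ := fun y hy =>
      dif_pos (hBK y hy)
    have hGcont : ContinuousOn G (simplex τ) := by
      rw [continuousOn_iff_continuous_domRestrict]
      have e : (simplex τ).domRestrict G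
          = fun y : simplex τ => (g ⟨B y, hBK y y.2⟩ : F) := funext fun y => hGeq y y.2
      rw [e]
      exact continuous_subtype_val.comp (hg.comp
        ((B.continuous_of_finiteDimensional.comp continuous_subtype_val).subtype_mk _))
    obtain ⟨y, hy, hGy⟩ := exists_eq_shrink_of_close (L.indep hτ.1) hτm.2 hε (hmax τ hτm).1
      hGcont (fun y hy => by
        have := hclose ⟨B y, hBK y hy⟩
        rwa [hhB y hy, ← hGeq y hy] at this) hzτ
      (fun y hy => (hmax τ hτm).2 z hzτ (G y) (hGeq y hy ▸ (g _).2))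
    refine ⟨⟨B y, hBK y hy⟩, ?_⟩
    change squeezingMap L hL ε (g ⟨B y, hBK y hy⟩) = z
    rw [← hGeq y hy, hGy, squeezingMap_eq hL hε hlt hτ
      (shrink_mem_simplex hne hε.le (hlt τ hτm).le hzτ), if_pos hτm,
      squeezeSimplex_shrink hne hε (hlt τ hτm) hzτ]
  · have hcard : τ.card = 1 := by
      have : ¬ 2 ≤ τ.card := fun h2 => hτm ⟨hτ, h2⟩
      omega
    obtain ⟨x, hx⟩ := hsurj ⟨z, hz⟩
    have hgx : (g x : F) ∈ simplex τ := hzero τ hτ hcard z hzτ _ (g x).2 (by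
      have := hclose x
      rwa [hx, ← dist_eq_norm, dist_comm] at this)
    refine ⟨x, ?_⟩
    change squeezingMap L hL ε (g x) = z
    rw [squeezingMap_eq hL hε hlt hτ hgx, if_neg hτm]
    obtain ⟨v, rfl⟩ := Finset.card_eq_one.1 hcard
    simp only [simplex, Finset.coe_singleton, convexHull_singleton, mem_singleton_iff] at hgx hzτ
    rw [hgx, hzτ]

theorem diam_simplex_le_maxDiam (hL : L.faces.Finite) {s : Finset F} (hs : s ∈ L.faces) :
    Metric.diam (simplex s) ≤ maxDiam L :=
  le_csSup (hL.image _).bddAbove (mem_image_of_mem _ hs)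

/-- Squeezing moves points by at most the maximal diameter of the simplices. -/
theorem uniformNorm_sub_squeezingMap_lt (hL : L.faces.Finite) {ε : ℝ} (hε : 0 < ε)
    (hlt : ∀ τ ∈ maximalSimplices L, ε < inradius τ)
    (hdim : ∃ s ∈ L.faces, 2 ≤ s.card)
    (hnorm : uniformNorm (fun x => (h x : F) - g x) < ε) :
    uniformNorm (fun x => (h x : F) - squeezingMap L hL ε (g x)) < 2 * maxDiam L := by
  obtain ⟨s, hs, hs2⟩ := hdim
  obtain ⟨t, ht, hst⟩ := exists_mem_facets_superset hL hs
  have ht2 : 2 ≤ t.card := hs2.trans (Finset.card_le_card hst)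
  have hεD : ε < maxDiam L := (hlt t ⟨ht, ht2⟩).trans_le
    ((inradius_le_diam ht2).trans (diam_simplex_le_maxDiam hL ht.1))
  have hle : uniformNorm (fun x => (h x : F) - squeezingMap L hL ε (g x))
      ≤ uniformNorm (fun x => (h x : F) - g x) + maxDiam L := by
    -- Nonnegativity of the bound covers an empty `|K|`.
    refine Real.iSup_le (fun x => ?_) (add_nonneg (uniformNorm_nonneg _) (hε.trans hεD).le)
    obtain ⟨τ, hτ, hx⟩ := exists_mem_facets_of_mem_space hL (g x).2
    have h1 := norm_le_uniformNorm_sub (isCompact_space hL).isBounded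
      (f := fun x => (h x : F)) (g := fun x => (g x : F)) (fun x => (h x).2) (fun x => (g x).2) x
    have h2 : ‖(g x : F) - squeezingMap L hL ε (g x)‖ ≤ maxDiam L := by
      rw [← dist_eq_norm]
      exact (Metric.dist_le_diam_of_mem (isCompact_simplex τ).isBounded hx
        (squeezingMap_mem_simplex hL hε hlt hτ hx)).trans (diam_simplex_le_maxDiam hL hτ.1)
    exact (norm_sub_le_norm_sub_add_norm_sub _ _ _).trans (add_le_add h1 h2)
  linarith

end Main

end Squeezing

theorem mainTheorem4 (n m : ℕ)
    (K : Geometry.SimplicialComplex ℝ (EuclideanSpace ℝ (Fin n))) (hK : K.faces.Finite)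
    (L : Geometry.SimplicialComplex ℝ (EuclideanSpace ℝ (Fin m))) (hL : L.faces.Finite)
    (h : K.space → L.space) (hsimp : Squeezing.IsSimplicialMap K L h)
    (hsurj : Function.Surjective h) :
    ∃ ε : ℝ, 0 < ε ∧ (∀ τ ∈ Squeezing.maximalSimplices L, ε < Squeezing.inradius τ) ∧
      ∀ g : K.space → L.space, Continuous g →
        Squeezing.uniformNorm
          (fun x => (h x : EuclideanSpace ℝ (Fin m)) - (g x : EuclideanSpace ℝ (Fin m))) < ε →
        Set.range (fun x => Squeezing.squeezingMap L hL ε (g x)) = L.space ∧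
        ((∃ s ∈ L.faces, 2 ≤ s.card) →
          Squeezing.uniformNorm
            (fun x => (h x : EuclideanSpace ℝ (Fin m)) - Squeezing.squeezingMap L hL ε (g x))
            < 2 * Squeezing.maxDiam L) := by
  have hfin : L.facets.Finite := hL.subset Geometry.SimplicialComplex.facets_subset
  -- Each smallness condition holds for all small positive `ε`, and there are finitely many, so a
  -- common `ε` exists.
  have hmax := (Filter.eventually_all_finite (Squeezing.finite_maximalSimplices hL)).2
    fun τ hτ => Squeezing.eventually_mem_simplex_of_dist_shrink_lt hL hτ
  have hzero := (Filter.eventually_all_finite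
    (hfin.subset (Set.sep_subset L.facets fun τ => τ.card = 1))).2
    fun τ hτ => Squeezing.eventually_mem_simplex_of_dist_lt hL hτ.1 hτ.2
  obtain ⟨ε, ⟨hmax, hzero⟩, hε⟩ :=
    ((hmax.and hzero).and (self_mem_nhdsWithin : Set.Ioi (0 : ℝ) ∈ nhdsWithin 0 (Set.Ioi 0))).exists
  have hε : 0 < ε := hε
  have hlt : ∀ τ ∈ Squeezing.maximalSimplices L, ε < Squeezing.inradius τ := fun τ hτ => by
    linarith [(hmax τ hτ).1]
  refine ⟨ε, hε, hlt, fun g hg hnorm => ⟨?_, fun hdim =>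
    Squeezing.uniformNorm_sub_squeezingMap_lt hL hε hlt hdim hnorm⟩⟩
  exact Squeezing.range_squeezingMap_comp hL hsimp hsurj hε hlt hmax
    (fun τ hτ hc => hzero τ ⟨hτ, hc⟩) hg fun x =>
      (Squeezing.norm_le_uniformNorm_sub (Squeezing.isCompact_space hL).isBounded
        (f := fun x => (h x : EuclideanSpace ℝ (Fin m)))
        (g := fun x => (g x : EuclideanSpace ℝ (Fin m)))
        (fun x => (h x).2) (fun x => (g x).2) x).trans_lt hnorm
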